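/- Let $G$ be a group with neutral element $\varepsilon$, and let $R=\bigoplus_{g\in G}R_g$ be a $G$-graded ring (associative with unit, not necessarily commutative), i.e. the $R_g$ are additive subgroups with $R_gR_h\subseteq R_{gh}$ for all $g,h\in G$. Let $R\text{-gr}$ be the category of graded left $R$-modules: its objects are left $R$-modules $M=\bigoplus_{g\in G}M_g$ with additive subgroups $M_g$ such that $R_gM_h\subseteq M_{gh}$ for all $g,h\in G$, and its morphisms $f:M\to N$ are the $R$-linear maps with $f(M_g)\subseteq N_g$ for all $g\in G$. Call $R$ graded quasi-Frobenius if it is graded left Noetherian (the graded left ideals of $R$ satisfy the ascending chain condition) and graded left injective ($R$, regarded as a graded left $R$-module, is an injective object of $R\text{-gr}$). **Theorem.** The following are equivalent: 1. $R$ is graded quasi-Frobenius. 2. The classes of injective objects and of projective objects of $R\text{-gr}$ coincide, i.e. an object of $R\text{-gr}$ is injective if and only if it is projective. -/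

import Mathlib

universe u v w

/-- The objects of the category `R-gr`, for a ring `R` graded by a group `G` with homogeneous
components `𝒜 g`: left `R`-modules `M` with a decomposition `M = ⨁ g, M_g` into additive subgroups
such that `R_g M_h ⊆ M_{g + h}`. The group law of `G` is written additively, as is Mathlib's
convention for gradings, but `G` is an arbitrary group, not assumed to be commutative. -/
structure GrModCat {G : Type u} [AddGroup G] [DecidableEq G] {R : Type v} [Ring R]
    (𝒜 : G → AddSubgroup R) where
  /-- The underlying type. -/
  carrier : Type w
  [addCommGroup : AddCommGroup carrier]
  [module : Module R carrier]
  /-- The homogeneous components. -/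
  grading : G → AddSubgroup carrier
  [decomposition : DirectSum.Decomposition grading]
  [gradedSMul : SetLike.GradedSMul 𝒜 grading]

namespace GrModCat

attribute [instance] GrModCat.addCommGroup GrModCat.module GrModCat.decomposition
  GrModCat.gradedSMul

variable {G : Type u} [AddGroup G] [DecidableEq G] {R : Type v} [Ring R]

/-- The morphisms of `R-gr`: `R`-linear maps `f : M → N` with `f (M_g) ⊆ N_g` for all `g`. -/
@[ext]
structure Hom {𝒜 : G → AddSubgroup R} (M N : GrModCat.{u, v, w} 𝒜) where
  /-- The underlying linear map. -/
  toLinearMap : M.carrier →ₗ[R] N.carrier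
  map_mem : ∀ (g : G) (x : M.carrier), x ∈ M.grading g → toLinearMap x ∈ N.grading g

/-- The category `R-gr` of graded left `R`-modules. -/
instance category (𝒜 : G → AddSubgroup R) :
    CategoryTheory.Category.{w} (GrModCat.{u, v, w} 𝒜) where
  Hom M N := Hom M N
  id M := ⟨LinearMap.id, fun _ _ hx => hx⟩
  comp f g := ⟨g.toLinearMap.comp f.toLinearMap,
    fun i _ hx => g.map_mem i _ (f.map_mem i _ hx)⟩

/-- The graded ring `R`, regarded as a graded left module over itself. -/
def self (𝒜 : G → AddSubgroup R) [GradedRing 𝒜] : GrModCat.{u, v, v} 𝒜 where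
  carrier := R
  grading := 𝒜

end GrModCat

/-- `R` is graded left Noetherian: its graded left ideals satisfy the ascending chain condition.
(Mathlib's `HomogeneousIdeal` consists of the homogeneous left ideals of `R`.) -/
def IsGradedLeftNoetherian {G : Type u} [AddGroup G] [DecidableEq G] {R : Type v} [Ring R]
    (𝒜 : G → AddSubgroup R) [GradedRing 𝒜] : Prop :=
  WellFoundedGT (HomogeneousIdeal 𝒜)

/-- `R` is graded left injective: it is an injective object of `R-gr` when regarded as a graded
left module over itself. -/
def IsGradedLeftInjective {G : Type u} [AddGroup G] [DecidableEq G] {R : Type v} [Ring R]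
    (𝒜 : G → AddSubgroup R) [GradedRing 𝒜] : Prop :=
  CategoryTheory.Injective (GrModCat.self 𝒜)

/-- `R` is graded quasi-Frobenius: it is graded left Noetherian and graded left injective. -/
def IsGradedQuasiFrobenius {G : Type u} [AddGroup G] [DecidableEq G] {R : Type v} [Ring R]
    (𝒜 : G → AddSubgroup R) [GradedRing 𝒜] : Prop :=
  IsGradedLeftNoetherian 𝒜 ∧ IsGradedLeftInjective 𝒜

/-!
The theorem is the graded form of the Faith–Walker characterization of quasi-Frobenius rings.

The category `R-gr` is replaced by a category of modules over one ungraded ring. Let `S` be the ring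
generated by `R` and orthogonal idempotents `p g`, for `g : G`, with `p (h + g) r = r p g` for `r` of
degree `h` (`Smash`). A graded module is the same as an `S`-module `N` that is the direct sum of
the `p g N` (`IdempotentSystem.Rational`), and graded submodules, graded quotients and
degree-preserving maps are submodules, quotients and maps over `S`. The translates of `R` become
the projective left ideals `P g = S p_g`, with `P 0 ≅ R`, and shifting degrees becomes restriction of
scalars along an automorphism of `S` (`IdempotentSystem.Tw`). "Graded quasi-Frobenius" says that
`P 0` is Noetherian and injective among rational modules, and `isNoetherian_and_isInj_iff` is the
theorem for rational modules.

Suppose that `P 0`, hence every `P g`, is Noetherian and injective. By Baer's criterion direct sums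
of injectives are injective, so projectives, being summands of sums of left ideals `P g`, are
injective (`IsProj.isInj`). Conversely an injective module is shown to be the direct sum of a maximal
independent family of submodules that are both injective and projective (`IsInj.isProj`). The
complement of that sum must vanish, because a nonzero injective module contains such a submodule:

* It has a simple submodule (`exists_isSimpleModule`). Indeed the maps between the `P g` with
  essential kernel are T-nilpotent by Noetherianity, and in fact nilpotent, uniformly by translation
  (`exists_le_annPow`). Modulo the images of these maps `P g` is semisimple, since a map that is not
  of this kind is injective on some nonzero direct summand
  (`isSemisimpleModule_quotient_singP`).
* Every simple module embeds into a translate of `P 0` (`exists_twEquiv_submodule`), where its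
  injective hull is a direct summand, hence projective. For this, call `T` the top of a simple `A` if
  it is a quotient of the injective hull `Q` of `A` and `Q` is projective. As the endomorphism ring of
  `Q` is local, `A` determines `T`, and every simple `T` is, up to translation, the top of a simple
  `A ≤ P 0`. Since `P 0` is Noetherian there are only finitely many such `A` up to isomorphism, so
  by counting classes every simple module is a translate of one of them. This is where it matters
  that the `P g` form a single orbit under translation.

If, on the other hand, injectives and projectives coincide, then `P 0` is injective, being projective,
and direct sums of injectives are injective, since direct sums of projectives are projective. Bass's
argument then shows that `P 0` is Noetherian (`isNoetherian_of_isInj_iff_isProj`). It needs enough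
injectives, which are obtained by cutting injective `S`-modules down to their rational parts.
-/

/-! ### Rings with a translation-invariant family of orthogonal idempotents -/

/-- A ring `S` with orthogonal idempotents `p g`, indexed by a group `G`, such that each left ideal
`S p_g` is the direct sum of the `p_h S p_g`, and on which `G` acts by automorphisms that translate
the idempotents. -/
structure IdempotentSystem (G : Type u) [AddGroup G] (S : Type w) [Ring S] where
  /-- The idempotents. -/
  p : G → S
  mul_self : ∀ g, p g * p g = p g
  mul_of_ne : ∀ g h, g ≠ h → p g * p h = 0
  exists_sum : ∀ (s : S) (g : G), ∃ F : Finset G, ∑ h ∈ F, p h * (s * p g) = s * p g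
  /-- The translations. -/
  shift : G → S ≃+* S
  shift_p : ∀ k g, shift k (p g) = p (g + k)
  shift_zero : ∀ s, shift 0 s = s
  shift_add : ∀ k l s, shift (k + l) s = shift l (shift k s)

namespace IdempotentSystem

variable {G : Type u} [AddGroup G] {S : Type w} [Ring S] (I : IdempotentSystem G S)

/-- A module over `S` is rational if it is the direct sum of its subgroups `p_g N`. Rational modules
play the role of graded modules. -/
class Rational (N : Type v) [AddCommGroup N] [Module S N] : Prop where
  exists_sum : ∀ x : N, ∃ F : Finset G, ∑ g ∈ F, I.p g • x = x

section Basic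

variable {N : Type v} [AddCommGroup N] [Module S N]

lemma p_smul_p_smul_self (g : G) (x : N) : I.p g • I.p g • x = I.p g • x := by
  rw [smul_smul, I.mul_self]

lemma p_smul_p_smul_of_ne {g h : G} (hgh : g ≠ h) (x : N) : I.p g • I.p h • x = 0 := by
  rw [smul_smul, I.mul_of_ne g h hgh, zero_smul]

lemma sum_of_subset {F F' : Finset G} (hF : F ⊆ F') {x : N} (hx : ∑ g ∈ F, I.p g • x = x) :
    ∑ g ∈ F', I.p g • x = x := by
  classical
  refine Eq.trans (Finset.sum_subset hF fun k _ hk => ?_).symm hx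
  rw [← hx, Finset.smul_sum]
  exact Finset.sum_eq_zero fun g hg =>
    I.p_smul_p_smul_of_ne (by rintro rfl; exact hk hg) x

variable (N) in
/-- The largest rational submodule of a module. -/
def rationalPart : Submodule S N where
  carrier := {x | ∃ F : Finset G, ∑ g ∈ F, I.p g • x = x}
  zero_mem' := ⟨∅, by simp⟩
  add_mem' := by
    classical
    rintro a b ⟨F, hF⟩ ⟨F', hF'⟩
    refine ⟨F ∪ F', ?_⟩
    simp only [smul_add, Finset.sum_add_distrib]
    rw [I.sum_of_subset Finset.subset_union_left hF, I.sum_of_subset Finset.subset_union_right hF']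
  smul_mem' := by
    classical
    rintro s x ⟨F, hF⟩
    choose F' hF' using fun g => I.exists_sum s g
    refine ⟨F.biUnion F', ?_⟩
    have key : ∀ g ∈ F, ∑ h ∈ F.biUnion F', I.p h • (s • I.p g • x) = s • I.p g • x := by
      intro g hg
      refine I.sum_of_subset (Finset.subset_biUnion_of_mem F' hg) ?_
      have := congrArg (· • x) (hF' g)
      simpa [Finset.sum_smul, mul_smul] using this
    conv_rhs => rw [← hF, Finset.smul_sum, ← Finset.sum_congr rfl key, Finset.sum_comm]
    refine Finset.sum_congr rfl fun h _ => ?_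
    rw [← Finset.smul_sum, ← Finset.smul_sum, hF]

lemma mem_rationalPart {x : N} : x ∈ I.rationalPart N ↔ ∃ F : Finset G, ∑ g ∈ F, I.p g • x = x :=
  Iff.rfl

lemma rational_of_rationalPart (h : I.rationalPart N = ⊤) : I.Rational N :=
  ⟨fun _ => I.mem_rationalPart.1 (h ▸ Submodule.mem_top)⟩

lemma rational_of_injective {N' : Type*} [AddCommGroup N'] [Module S N'] [I.Rational N']
    (f : N →ₗ[S] N') (hf : Function.Injective f) : I.Rational N :=
  ⟨fun x => by
    obtain ⟨F, hF⟩ := Rational.exists_sum (I := I) (f x)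
    exact ⟨F, hf (by simpa using hF)⟩⟩

lemma rational_of_surjective {N' : Type*} [AddCommGroup N'] [Module S N'] [I.Rational N']
    (f : N' →ₗ[S] N) (hf : Function.Surjective f) : I.Rational N :=
  ⟨fun x => by
    obtain ⟨y, rfl⟩ := hf x
    obtain ⟨F, hF⟩ := Rational.exists_sum (I := I) y
    exact ⟨F, by conv_rhs => rw [← hF]
                 simp⟩⟩

lemma map_mem_rationalPart {N' : Type*} [AddCommGroup N'] [Module S N'] [I.Rational N']
    (f : N' →ₗ[S] N) (x : N') : f x ∈ I.rationalPart N := by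
  obtain ⟨F, hF⟩ := Rational.exists_sum (I := I) x
  exact ⟨F, by conv_rhs => rw [← hF]
               simp⟩

instance rational_rationalPart : I.Rational (I.rationalPart N) :=
  ⟨fun ⟨x, F, hF⟩ => ⟨F, Subtype.ext (by simpa using hF)⟩⟩

instance rational_submodule [I.Rational N] (L : Submodule S N) : I.Rational L :=
  I.rational_of_injective L.subtype L.injective_subtype

instance rational_quotient [I.Rational N] (L : Submodule S N) : I.Rational (N ⧸ L) :=
  I.rational_of_surjective L.mkQ L.mkQ_surjective

instance rational_directSum {ι : Type*} (M : ι → Type*) [∀ i, AddCommGroup (M i)]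
    [∀ i, Module S (M i)] [∀ i, I.Rational (M i)] : I.Rational (DirectSum ι M) := by
  classical
  refine I.rational_of_rationalPart (eq_top_iff.2 fun x _ => ?_)
  induction x using DirectSum.induction_on with
  | zero => exact zero_mem _
  | of i x => exact I.map_mem_rationalPart (DirectSum.lof S ι M i) x
  | add x y hx hy => exact add_mem (hx trivial) (hy trivial)

lemma exists_p_smul_ne_zero [I.Rational N] {x : N} (hx : x ≠ 0) : ∃ g, I.p g • x ≠ 0 := by
  by_contra! h
  obtain ⟨F, hF⟩ := Rational.exists_sum (I := I) x
  exact hx (by rw [← hF, Finset.sum_eq_zero fun g _ => h g])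

lemma le_of_homogeneous [I.Rational N] {L L' : Submodule S N}
    (h : ∀ g, ∀ x ∈ L, I.p g • x = x → x ∈ L') : L ≤ L' := by
  intro x hx
  obtain ⟨F, hF⟩ := Rational.exists_sum (I := I) x
  rw [← hF]
  exact sum_mem fun g _ => h g _ (L.smul_mem _ hx) (I.p_smul_p_smul_self g x)

end Basic

/-- The left ideal `S p_g`. It represents the functor `N ↦ p_g N`. -/
def P (g : G) : Submodule S S := Submodule.span S {I.p g}

lemma p_mem_P (g : G) : I.p g ∈ I.P g := Submodule.mem_span_singleton_self _

lemma mem_P {g : G} {s : S} : s ∈ I.P g ↔ s * I.p g = s := by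
  rw [P, Submodule.mem_span_singleton]
  constructor
  · rintro ⟨a, rfl⟩
    rw [smul_eq_mul, mul_assoc, I.mul_self]
  · exact fun h => ⟨s, h⟩

lemma mul_p_mem_P (s : S) (g : G) : s * I.p g ∈ I.P g := by
  rw [mem_P, mul_assoc, I.mul_self]

lemma coe_mul_p {g : G} (s : I.P g) : (s : S) * I.p g = s := I.mem_P.1 s.2

instance rational_P (g : G) : I.Rational (I.P g) :=
  ⟨fun s => by
    obtain ⟨F, hF⟩ := I.exists_sum s g
    exact ⟨F, Subtype.ext (by simpa [I.coe_mul_p] using hF)⟩⟩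

/-- The morphism `S p_g → N` given by an element `x` of `N`. It sends `p_g` to `p_g x`. -/
def ofP {N : Type v} [AddCommGroup N] [Module S N] (g : G) (x : N) : I.P g →ₗ[S] N :=
  (LinearMap.toSpanSingleton S N x).comp (I.P g).subtype

@[simp]
lemma ofP_apply {N : Type v} [AddCommGroup N] [Module S N] (g : G) (x : N) (s : I.P g) :
    I.ofP g x s = (s : S) • x := rfl

lemma eq_ofP {N : Type v} [AddCommGroup N] [Module S N] (g : G) (f : I.P g →ₗ[S] N) :
    f = I.ofP g (f ⟨I.p g, I.p_mem_P g⟩) := by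
  ext s
  rw [ofP_apply, ← map_smul]
  exact congrArg f (Subtype.ext (I.coe_mul_p s).symm)

/-! ### Translates of modules -/

/-- The translate of a module: restriction of scalars along the automorphism `shift k`. -/
def Tw (_ : IdempotentSystem G S) (_ : G) (N : Type v) : Type v := N

section Tw

variable (k : G) (N : Type v) [AddCommGroup N]

instance : AddCommGroup (I.Tw k N) := inferInstanceAs (AddCommGroup N)

variable [Module S N]

instance : Module S (I.Tw k N) := Module.compHom N (I.shift k : S →+* S)

/-- The identity map from a module to its translate. -/
def toTw : N ≃+ I.Tw k N := AddEquiv.refl N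

variable {N}

lemma smul_toTw (s : S) (x : N) : s • I.toTw k N x = I.toTw k N (I.shift k s • x) := rfl

lemma toTw_symm_smul (s : S) (x : I.Tw k N) :
    (I.toTw k N).symm (s • x) = I.shift k s • (I.toTw k N).symm x := rfl

lemma shift_neg_shift (s : S) : I.shift (-k) (I.shift k s) = s := by
  rw [← I.shift_add, add_neg_cancel, I.shift_zero]

lemma shift_shift_neg (s : S) : I.shift k (I.shift (-k) s) = s := by
  rw [← I.shift_add, neg_add_cancel, I.shift_zero]

lemma toTw_smul (s : S) (x : N) : I.toTw k N (s • x) = I.shift (-k) s • I.toTw k N x := by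
  rw [smul_toTw, shift_shift_neg]

instance rational_Tw [I.Rational N] : I.Rational (I.Tw k N) :=
  ⟨fun x => by
    classical
    obtain ⟨F, hF⟩ := Rational.exists_sum (I := I) ((I.toTw k N).symm x)
    refine ⟨F.map ⟨fun g => g + -k, add_left_injective _⟩, (I.toTw k N).symm.injective ?_⟩
    rw [map_sum, Finset.sum_map, ← hF]
    refine Finset.sum_congr rfl fun g _ => ?_
    rw [toTw_symm_smul, I.shift_p, Function.Embedding.coeFn_mk, neg_add_cancel_right]⟩

/-- Translation of a linear map. -/
def twMap {N' : Type*} [AddCommGroup N'] [Module S N'] (f : N →ₗ[S] N') :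
    I.Tw k N →ₗ[S] I.Tw k N' where
  toFun x := I.toTw k N' (f ((I.toTw k N).symm x))
  map_add' x y := by simp
  map_smul' s x := by
    rw [toTw_symm_smul, map_smul, RingHom.id_apply, smul_toTw]

/-- Translation of a linear equivalence. -/
noncomputable def twCongr {N' : Type*} [AddCommGroup N'] [Module S N'] (f : N ≃ₗ[S] N') :
    I.Tw k N ≃ₗ[S] I.Tw k N' :=
  LinearEquiv.ofBijective (I.twMap k f.toLinearMap)
    ((I.toTw k N').bijective.comp (f.bijective.comp (I.toTw k N).symm.bijective))

/-- Translating twice. -/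
def twTw (l : G) : I.Tw k (I.Tw l N) ≃ₗ[S] I.Tw (k + l) N where
  toAddEquiv := ((I.toTw k _).symm.trans (I.toTw l N).symm).trans (I.toTw (k + l) N)
  map_smul' s x := by
    simp [toTw_symm_smul, smul_toTw, I.shift_add]

variable (N) in
/-- Translating by zero. -/
def twZero : I.Tw 0 N ≃ₗ[S] N where
  toAddEquiv := (I.toTw 0 N).symm
  map_smul' s x := by
    simp [toTw_symm_smul, I.shift_zero]

variable (N) in
/-- Cancelling a translation. -/
def twNegTw : I.Tw (-k) (I.Tw k N) ≃ₗ[S] N where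
  toAddEquiv := (I.toTw (-k) _).symm.trans (I.toTw k N).symm
  map_smul' s x := by
    simp [toTw_symm_smul, I.shift_shift_neg]

variable (N) in
/-- Cancelling a translation. -/
def twTwNeg : I.Tw k (I.Tw (-k) N) ≃ₗ[S] N where
  toAddEquiv := (I.toTw k _).symm.trans (I.toTw (-k) N).symm
  map_smul' s x := by
    simp [toTw_symm_smul, I.shift_neg_shift]

variable (N) in
/-- The identity map from a translate back to the module, as a semilinear map. -/
def ofTw : I.Tw k N →ₛₗ[(I.shift k : S →+* S)] N where
  toFun := (I.toTw k N).symm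
  map_add' := map_add _
  map_smul' _ _ := rfl

lemma ofTw_bijective : Function.Bijective (I.ofTw k N) := (I.toTw k N).symm.bijective

lemma isSimpleModule_Tw_iff : IsSimpleModule S (I.Tw k N) ↔ IsSimpleModule S N :=
  have : RingHomSurjective (I.shift k : S →+* S) := ⟨(I.shift k).surjective⟩
  LinearMap.isSimpleModule_iff_of_bijective (I.ofTw k N) (I.ofTw_bijective k)

instance [IsNoetherian S N] : IsNoetherian S (I.Tw k N) := by
  have : RingHomSurjective (I.shift k : S →+* S) := ⟨(I.shift k).surjective⟩
  rw [isNoetherian_iff'] at *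
  exact (Submodule.map_strictMono_of_injective (f := I.ofTw k N)
    (I.ofTw_bijective k).injective).wellFoundedGT

end Tw

lemma shift_mem_P {g : G} (k : G) {s : S} (hs : s ∈ I.P g) : I.shift k s ∈ I.P (g + k) := by
  rw [mem_P] at *
  rw [← I.shift_p, ← map_mul, hs]

/-- The left ideals `S p_g` are translates of each other. -/
def PEquivTw (k : G) : I.P k ≃ₗ[S] I.Tw (-k) (I.P 0) where
  toFun s := I.toTw (-k) _ ⟨I.shift (-k) s, by simpa using I.shift_mem_P (-k) s.2⟩
  invFun s := ⟨I.shift k ((I.toTw (-k) _).symm s : I.P 0), by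
    simpa using I.shift_mem_P k ((I.toTw (-k) _).symm s : I.P 0).2⟩
  map_add' a b := by
    rw [← map_add]
    congr 1
    ext
    simp
  map_smul' s a := by
    rw [RingHom.id_apply, smul_toTw]
    congr 1
    ext
    simp
  left_inv a := by simp [shift_shift_neg]
  right_inv a := by simp [shift_neg_shift]

lemma isNoetherian_P [IsNoetherian S (I.P 0)] (g : G) : IsNoetherian S (I.P g) :=
  isNoetherian_of_linearEquiv (I.PEquivTw g).symm

end IdempotentSystem

namespace IdempotentSystem

variable {G : Type u} [AddGroup G] {S : Type w} [Ring S] (I : IdempotentSystem G S)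

/-! ### Injective rational modules -/

/-- Injectivity with respect to monomorphisms between rational modules. -/
def IsInj (N : Type w) [AddCommGroup N] [Module S N] : Prop :=
  ∀ (X Y : Type w) [AddCommGroup X] [Module S X] [AddCommGroup Y] [Module S Y]
    [I.Rational X] [I.Rational Y] (f : X →ₗ[S] Y), Function.Injective f → ∀ g : X →ₗ[S] N,
      ∃ h : Y →ₗ[S] N, ∀ x, h (f x) = g x

variable {I}

section

variable {N N' : Type w} [AddCommGroup N] [Module S N] [AddCommGroup N'] [Module S N']

lemma IsInj.of_retract (h : I.IsInj N') (i : N →ₗ[S] N') (r : N' →ₗ[S] N)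
    (hri : ∀ x, r (i x) = x) : I.IsInj N := by
  intro X Y _ _ _ _ _ _ f hf g
  obtain ⟨k, hk⟩ := h X Y f hf (i.comp g)
  exact ⟨r.comp k, fun x => by simp [hk, hri]⟩

lemma IsInj.of_equiv (h : I.IsInj N') (e : N ≃ₗ[S] N') : I.IsInj N :=
  h.of_retract e.toLinearMap e.symm.toLinearMap (by simp)

lemma IsInj.prod (h : I.IsInj N) (h' : I.IsInj N') : I.IsInj (N × N') := by
  intro X Y _ _ _ _ _ _ f hf g
  obtain ⟨k, hk⟩ := h X Y f hf ((LinearMap.fst S N N').comp g)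
  obtain ⟨k', hk'⟩ := h' X Y f hf ((LinearMap.snd S N N').comp g)
  exact ⟨k.prod k', fun x => by ext <;> simp [hk, hk']⟩

lemma IsInj.tw (h : I.IsInj N) (k : G) : I.IsInj (I.Tw k N) := by
  intro X Y _ _ _ _ _ _ f hf g
  obtain ⟨φ, hφ⟩ := h (I.Tw (-k) X) (I.Tw (-k) Y) (I.twMap (-k) f) (fun a b hab => hf hab)
    ((I.twNegTw k N).toLinearMap.comp (I.twMap (-k) g))
  refine ⟨
    { toFun := fun y => I.toTw k N (φ (I.toTw (-k) Y y))
      map_add' := by simp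
      map_smul' := fun s y => by
        rw [toTw_smul, neg_neg, map_smul, RingHom.id_apply, smul_toTw] }, fun x => ?_⟩
  exact congrArg (I.toTw k N) (hφ (I.toTw (-k) X x))

lemma IsInj.of_isCompl (h : I.IsInj N) {D C : Submodule S N} (hDC : IsCompl D C) : I.IsInj D :=
  h.of_retract D.subtype (Submodule.projectionOnto D C hDC)
    (Submodule.projectionOnto_apply_left hDC)

lemma IsInj.exists_isCompl [I.Rational N] {D : Submodule S N} (h : I.IsInj D) :
    ∃ C, IsCompl D C := by
  obtain ⟨r, hr⟩ := h D N D.subtype D.injective_subtype LinearMap.id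
  exact ⟨_, LinearMap.isCompl_of_proj hr⟩

lemma IsInj.sup {D D' : Submodule S N} (h : I.IsInj D) (h' : I.IsInj D') (hd : Disjoint D D') :
    I.IsInj (D ⊔ D' : Submodule S N) := by
  have hinj : Function.Injective (D.subtype.coprod D'.subtype) := by
    rw [← LinearMap.ker_eq_bot, LinearMap.ker_coprod_of_disjoint_range _ _ (by simpa using hd)]
    simp
  have hr : LinearMap.range (D.subtype.coprod D'.subtype) = D ⊔ D' := by
    simp [LinearMap.range_coprod]
  exact (h.prod h').of_equiv ((LinearEquiv.ofInjective _ hinj).trans (LinearEquiv.ofEq _ _ hr)).symm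

lemma IsInj.map {D : Submodule S N} (h : I.IsInj D) (f : N →ₗ[S] N')
    (hf : Disjoint D (LinearMap.ker f)) : I.IsInj (D.map f) := by
  refine h.of_equiv (LinearEquiv.ofBijective (f.submoduleMap D) ⟨?_, f.submoduleMap_surjective D⟩).symm
  rw [← LinearMap.ker_eq_bot, LinearMap.ker_eq_bot']
  rintro ⟨x, hx⟩ h0
  exact Subtype.ext (Submodule.disjoint_def.1 hf x hx (congrArg Subtype.val h0))

end

/-- Baer's criterion, tested on the left ideals below the `S p_g` only. A map on `S p_g` is given by
an element `x`. -/
theorem isInj_of_baer {N : Type w} [AddCommGroup N] [Module S N]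
    (h : ∀ (g : G) (L : Submodule S S), L ≤ I.P g → ∀ f : L →ₗ[S] N, ∃ x : N, ∀ s : L,
      f s = (s : S) • x) : I.IsInj N := by
  intro X Y _ _ _ _ _ _ f hf g
  let f₀ : Y →ₗ.[S] N := ⟨LinearMap.range f, g.comp (LinearEquiv.ofInjective f hf).symm.toLinearMap⟩
  obtain ⟨m, hm, hmax⟩ := zorn_le_nonempty_Ici₀ f₀ (fun c hc hchain y hy =>
    ⟨LinearPMap.sSup c hchain.directedOn, fun z hz => LinearPMap.le_sSup hchain.directedOn hz⟩)
    f₀ le_rfl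
  have hdom : m.domain = ⊤ := by
    refine eq_top_iff.2 (I.le_of_homogeneous fun k y _ hy => ?_)
    -- the elements of `S p_k` that multiply `y` into the domain of `m`
    let L : Submodule S S := I.P k ⊓ m.domain.comap (LinearMap.toSpanSingleton S Y y)
    let φ : L →ₗ[S] m.domain :=
      ((LinearMap.toSpanSingleton S Y y).comp L.subtype).codRestrict m.domain (fun s => s.2.2)
    obtain ⟨x, hx⟩ := h k L inf_le_left (m.toFun.comp φ)
    have hφ : ∀ (s : S) (hs : s • y ∈ m.domain), m ⟨s • y, hs⟩ = (s * I.p k) • x := by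
      intro s hs
      rw [← hx ⟨s * I.p k, I.mul_p_mem_P s k, by simpa [mul_smul, hy] using hs⟩]
      refine congrArg m.toFun (Subtype.ext ?_)
      change s • y = (s * I.p k) • y
      rw [mul_smul, hy]
    have hann : ∀ s : S, s • y = 0 → (s * I.p k) • x = 0 := by
      intro s hs
      have h0 : s • y ∈ m.domain := by rw [hs]; exact zero_mem _
      rw [← hφ s h0]
      have : (⟨s • y, h0⟩ : m.domain) = 0 := Subtype.ext hs
      rw [this, LinearPMap.map_zero]
    let ψ : Y →ₗ.[S] N := LinearPMap.mkSpanSingleton' y (I.p k • x) (fun s hs => by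
      rw [smul_smul]; exact hann s hs)
    have hagree : ∀ (a : m.domain) (b : ψ.domain), (a : Y) = b → m a = ψ b := by
      rintro ⟨a, ha⟩ ⟨b, hb⟩ rfl
      obtain ⟨s, rfl⟩ := Submodule.mem_span_singleton.1 hb
      rw [hφ s ha]
      refine Eq.trans ?_ (LinearPMap.mkSpanSingleton'_apply y (I.p k • x) _ s hb).symm
      rw [smul_smul]
      rfl
    have hle := hmax (LinearPMap.left_le_sup m ψ hagree)
    exact (hle.1.trans' (LinearPMap.right_le_sup m ψ hagree).1)
      (Submodule.mem_span_singleton_self y)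
  refine ⟨m.toFun.comp (LinearMap.codRestrict m.domain LinearMap.id fun y => hdom ▸ trivial),
    fun x => ?_⟩
  have := hm.2 (x := ⟨f x, x, rfl⟩) (y := ⟨f x, hdom ▸ trivial⟩) rfl
  refine this.symm.trans (congrArg g ?_)
  exact (LinearEquiv.ofInjective f hf).symm_apply_apply x

lemma IsInj.baer {N : Type w} [AddCommGroup N] [Module S N] (h : I.IsInj N) (g : G)
    (L : Submodule S S) (hL : L ≤ I.P g) (f : L →ₗ[S] N) : ∃ x : N, ∀ s : L, f s = (s : S) • x := by
  have : I.Rational L := I.rational_of_injective (Submodule.inclusion hL)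
    (Submodule.inclusion_injective hL)
  obtain ⟨k, hk⟩ := h L (I.P g) (Submodule.inclusion hL) (Submodule.inclusion_injective hL) f
  refine ⟨k ⟨I.p g, I.p_mem_P g⟩, fun s => ?_⟩
  rw [← hk, I.eq_ofP g k]
  simp [smul_smul, I.mem_P.1 (hL s.2)]

theorem isInj_directSum [∀ g, IsNoetherian S (I.P g)] {ι : Type w} (M : ι → Type w)
    [∀ i, AddCommGroup (M i)] [∀ i, Module S (M i)] (h : ∀ i, I.IsInj (M i)) :
    I.IsInj (DirectSum ι M) := by
  classical
  refine isInj_of_baer fun g L hL f => ?_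
  have : IsNoetherian S L := isNoetherian_of_injective (Submodule.inclusion hL)
    (Submodule.inclusion_injective hL)
  obtain ⟨T, hT⟩ := (Module.Finite.fg_top : (⊤ : Submodule S L).FG)
  let F : Finset ι := T.biUnion fun t => DFinsupp.support (f t)
  have hF : ∀ i ∉ F, (DirectSum.component S ι M i).comp f = 0 := by
    intro i hi
    rw [← LinearMap.ker_eq_top, ← top_le_iff, ← hT, Submodule.span_le]
    intro t ht
    by_contra hne
    exact hi (Finset.mem_biUnion.2 ⟨t, ht, DFinsupp.mem_support_iff.2 hne⟩)
  choose x hx using fun i => (h i).baer g L hL ((DirectSum.component S ι M i).comp f)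
  refine ⟨∑ i ∈ F, DirectSum.lof S ι M i (x i), fun s => ?_⟩
  rw [Finset.smul_sum]
  refine DirectSum.ext_component S fun i => ?_
  rw [map_sum]
  by_cases hi : i ∈ F
  · rw [Finset.sum_eq_single_of_mem i hi]
    · simpa [DirectSum.component.lof_self] using hx i s
    · intro j _ hj
      rw [map_smul, DirectSum.component.of, dif_neg hj, smul_zero]
  · rw [Finset.sum_eq_zero]
    · exact LinearMap.congr_fun (hF i hi) s
    · intro j hj
      rw [map_smul, DirectSum.component.of, dif_neg (by rintro rfl; exact hi hj), smul_zero]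

/-- Injective hulls inside an injective module: every submodule `A` is essential in a direct
summand `D`. -/
theorem IsInj.exists_hull {Q : Type w} [AddCommGroup Q] [Module S Q] [I.Rational Q]
    (h : I.IsInj Q) (A : Submodule S Q) :
    ∃ D C : Submodule S Q, A ≤ D ∧ IsCompl D C ∧ ∀ L ≤ D, Disjoint L A → L = ⊥ := by
  -- `C` is maximal among the submodules disjoint from `A`, and `D ≥ A` among those disjoint
  -- from `C`
  obtain ⟨C, -, hC⟩ := zorn_le_nonempty₀ {C : Submodule S Q | Disjoint C A}
    (fun c hc hchain y hy => ⟨sSup c, hchain.directedOn.disjoint_sSup_left.2 hc,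
      fun z hz => le_sSup hz⟩) ⊥ disjoint_bot_left
  obtain ⟨D, hAD, hD⟩ := zorn_le_nonempty₀ {D : Submodule S Q | Disjoint D C}
    (fun c hc hchain y hy => ⟨sSup c, hchain.directedOn.disjoint_sSup_left.2 hc,
      fun z hz => le_sSup hz⟩) A hC.1.symm
  have hCmax : ∀ K, C ≤ K → Disjoint K A → K ≤ C := fun K hK hKA => hC.2 hKA hK
  have hDC : Disjoint D C := hD.1
  obtain ⟨ψ, hψ⟩ := h D (Q ⧸ C) (C.mkQ.comp D.subtype) (by
    rw [← LinearMap.ker_eq_bot, LinearMap.ker_eq_bot']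
    rintro ⟨x, hx⟩ h0
    exact Subtype.ext (Submodule.disjoint_def.1 hDC x hx
      ((Submodule.Quotient.mk_eq_zero C).1 h0))) D.subtype
  let e : Q →ₗ[S] Q := ψ.comp C.mkQ
  have he : ∀ x ∈ D, e x = x := fun x hx => hψ ⟨x, hx⟩
  have heC : ∀ x ∈ C, e x = 0 := fun x hx => by
    have : C.mkQ x = 0 := (Submodule.Quotient.mk_eq_zero C).2 hx
    simp [e, this]
  have hrange : LinearMap.range e ≤ D := by
    refine hD.2 ?_ fun x hx => ⟨x, he x hx⟩
    refine Submodule.disjoint_def.2 ?_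
    rintro _ ⟨x, rfl⟩ hx
    refine heC x (hCmax (C.comap e) (fun y hy => ?_) ?_ hx)
    · change e y ∈ C
      rw [heC y hy]
      exact zero_mem _
    · refine Submodule.disjoint_def.2 fun y hy hyA => ?_
      have : e y ∈ C := hy
      rw [he y (hAD hyA)] at this
      exact Submodule.disjoint_def.1 hC.1 y this hyA
  refine ⟨D, _, hAD, LinearMap.isCompl_of_proj
    (f := e.codRestrict D fun x => hrange ⟨x, rfl⟩) fun x => Subtype.ext (he x x.2), ?_⟩
  intro L hLD hLA
  have hLC : L ≤ C := by
    refine le_trans le_sup_right (hCmax (C ⊔ L) le_sup_left (Submodule.disjoint_def.2 ?_))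
    intro x hx hxA
    obtain ⟨c, hc, l, hl, rfl⟩ := Submodule.mem_sup.1 hx
    have hcD : c ∈ D := by simpa using D.sub_mem (hAD hxA) (hLD hl)
    obtain rfl := Submodule.disjoint_def.1 hDC c hcD hc
    rw [zero_add] at hxA ⊢
    exact Submodule.disjoint_def.1 hLA l hl hxA
  exact eq_bot_iff.2 (hDC hLD hLC)

end IdempotentSystem

namespace IdempotentSystem

variable {G : Type u} [AddGroup G] {S : Type w} [Ring S] (I : IdempotentSystem G S)

/-! ### Projective rational modules -/

/-- Projectivity with respect to epimorphisms between rational modules. -/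
def IsProj (N : Type w) [AddCommGroup N] [Module S N] : Prop :=
  ∀ (X Y : Type w) [AddCommGroup X] [Module S X] [AddCommGroup Y] [Module S Y]
    [I.Rational X] [I.Rational Y] (f : X →ₗ[S] Y), Function.Surjective f → ∀ g : N →ₗ[S] Y,
      ∃ h : N →ₗ[S] X, ∀ x, f (h x) = g x

variable {I}

section

variable {N N' : Type w} [AddCommGroup N] [Module S N] [AddCommGroup N'] [Module S N']

lemma IsProj.of_retract (h : I.IsProj N') (i : N →ₗ[S] N') (r : N' →ₗ[S] N)
    (hri : ∀ x, r (i x) = x) : I.IsProj N := by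
  intro X Y _ _ _ _ _ _ f hf g
  obtain ⟨k, hk⟩ := h X Y f hf (g.comp r)
  exact ⟨k.comp i, fun x => by simp [hk, hri]⟩

lemma IsProj.of_equiv (h : I.IsProj N') (e : N ≃ₗ[S] N') : I.IsProj N :=
  h.of_retract e.toLinearMap e.symm.toLinearMap (by simp)

lemma IsProj.tw (h : I.IsProj N) (k : G) : I.IsProj (I.Tw k N) := by
  intro X Y _ _ _ _ _ _ f hf g
  obtain ⟨φ, hφ⟩ := h (I.Tw (-k) X) (I.Tw (-k) Y) (I.twMap (-k) f) (fun y => hf y)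
    ((I.twMap (-k) g).comp (I.twNegTw k N).symm.toLinearMap)
  refine ⟨
    { toFun := fun y => (I.toTw (-k) X).symm (φ ((I.toTw k N).symm y))
      map_add' := by simp
      map_smul' := fun s y => by
        rw [toTw_symm_smul, map_smul, toTw_symm_smul, RingHom.id_apply, shift_neg_shift] },
    fun x => ?_⟩
  exact congrArg (I.toTw (-k) Y).symm (hφ ((I.toTw k N).symm x))

lemma IsProj.of_isCompl (h : I.IsProj N) {D C : Submodule S N} (hDC : IsCompl D C) : I.IsProj D :=
  h.of_retract D.subtype (Submodule.projectionOnto D C hDC)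
    (Submodule.projectionOnto_apply_left hDC)

end

variable (I) in
lemma isProj_P (g : G) : I.IsProj (I.P g) := by
  intro X Y _ _ _ _ _ _ f hf k
  obtain ⟨x, hx⟩ := hf (k ⟨I.p g, I.p_mem_P g⟩)
  refine ⟨I.ofP g x, fun s => ?_⟩
  rw [ofP_apply, map_smul, hx, I.eq_ofP g k]
  simp [smul_smul, I.coe_mul_p]

lemma isProj_directSum {ι : Type w} (M : ι → Type w)
    [∀ i, AddCommGroup (M i)] [∀ i, Module S (M i)] (h : ∀ i, I.IsProj (M i)) :
    I.IsProj (DirectSum ι M) := by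
  classical
  intro X Y _ _ _ _ _ _ f hf g
  choose k hk using fun i => h i X Y f hf (g.comp (DirectSum.lof S ι M i))
  refine ⟨DirectSum.toModule S ι X k, fun x => ?_⟩
  rw [← LinearMap.comp_apply]
  refine LinearMap.congr_fun (DirectSum.linearMap_ext S fun i => LinearMap.ext fun x => ?_) x
  simpa using hk i x

/-- A projective rational module is a retract of a direct sum of left ideals `S p_g`. -/
lemma IsProj.exists_retract {N : Type w} [AddCommGroup N] [Module S N] [I.Rational N]
    (h : I.IsProj N) : ∃ (ι : Type w) (γ : ι → G) (i : N →ₗ[S] DirectSum ι fun j => I.P (γ j))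
      (r : DirectSum ι (fun j => I.P (γ j)) →ₗ[S] N), ∀ x, r (i x) = x := by
  classical
  let ι : Type w := {x : N // ∃ g, I.p g • x = x}
  let γ : ι → G := fun x => x.2.choose
  have hγ : ∀ x : ι, I.p (γ x) • (x : N) = x := fun x => x.2.choose_spec
  let r : DirectSum ι (fun j => I.P (γ j)) →ₗ[S] N :=
    DirectSum.toModule S ι N fun j => I.ofP (γ j) (j : N)
  have hr : LinearMap.range r = ⊤ := by
    refine eq_top_iff.2 (I.le_of_homogeneous fun g x _ hx => ?_)
    refine ⟨DirectSum.lof S ι _ ⟨x, g, hx⟩ ⟨_, I.p_mem_P _⟩, ?_⟩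
    simpa [r] using hγ ⟨x, g, hx⟩
  obtain ⟨i, hi⟩ := h _ N r (LinearMap.range_eq_top.1 hr) LinearMap.id
  exact ⟨ι, γ, i, r, hi⟩

theorem IsProj.isInj [∀ g, IsNoetherian S (I.P g)] (hinj : ∀ g, I.IsInj (I.P g))
    {N : Type w} [AddCommGroup N] [Module S N] [I.Rational N] (h : I.IsProj N) : I.IsInj N := by
  obtain ⟨ι, γ, i, r, hri⟩ := h.exists_retract
  exact (isInj_directSum _ fun j => hinj (γ j)).of_retract i r hri

end IdempotentSystem

namespace IdempotentSystem

open scoped Pointwise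

variable {G : Type u} [AddGroup G] {S : Type w} [Ring S] (I : IdempotentSystem G S)

/-! ### Singular elements -/

/-- The elements `a ∈ p_g S p_h` that are annihilated by an essential submodule of `S p_g`. -/
def sing : Set S :=
  {a | ∃ g h, I.p g * a = a ∧ a ∈ I.P h ∧ ∀ L ≤ I.P g, L ≠ ⊥ → ∃ s ∈ L, s ≠ 0 ∧ s * a = 0}

variable {I}

lemma exists_mul_eq_zero_of_sing {a : S} (ha : a ∈ I.sing) {k : G} {L : Submodule S S}
    (hL : L ≤ I.P k) (hL0 : L ≠ ⊥) : ∃ s ∈ L, s ≠ 0 ∧ s * a = 0 := by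
  obtain ⟨g, h, hga, -, hess⟩ := ha
  by_cases hk : k = g
  · subst hk
    exact hess L hL hL0
  · obtain ⟨s, hs, hs0⟩ := Submodule.exists_mem_ne_zero_of_ne_bot hL0
    refine ⟨s, hs, hs0, ?_⟩
    rw [← hga, ← I.mem_P.1 (hL hs), mul_assoc, ← mul_assoc (I.p k), I.mul_of_ne k g hk, zero_mul,
      mul_zero]

lemma shift_mem_sing {a : S} (ha : a ∈ I.sing) (k : G) : I.shift k a ∈ I.sing := by
  obtain ⟨g, h, hga, hah, hess⟩ := ha
  refine ⟨g + k, h + k, by rw [← I.shift_p, ← map_mul, hga], I.shift_mem_P k hah, ?_⟩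
  intro L hL hL0
  let L' : Submodule S S :=
    { carrier := {s | I.shift k s ∈ L}
      zero_mem' := by simp
      add_mem' := fun {a b} ha hb => by
        simpa using L.add_mem ha hb
      smul_mem' := fun t a ha => by
        simpa using L.smul_mem (I.shift k t) ha }
  have hL' : L' ≤ I.P g := fun s hs => by
    have := I.shift_mem_P (-k) (hL hs)
    rwa [shift_neg_shift, add_neg_cancel_right] at this
  obtain ⟨t, ht, ht0⟩ := Submodule.exists_mem_ne_zero_of_ne_bot hL0
  obtain ⟨s, hs, hs0, hsa⟩ := hess L' hL' fun h => by
    have : I.shift (-k) t ∈ L' := by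
      change I.shift k (I.shift (-k) t) ∈ L
      rwa [shift_shift_neg]
    rw [h, Submodule.mem_bot] at this
    exact ht0 (by simpa using this)
  exact ⟨I.shift k s, hs, by simpa using hs0, by rw [← map_mul, hsa, map_zero]⟩

lemma shift_mem_sing_pow {n : ℕ} {t : S} (ht : t ∈ I.sing ^ n) (k : G) :
    I.shift k t ∈ I.sing ^ n := by
  induction n generalizing t with
  | zero =>
    rw [pow_zero, Set.mem_one] at *
    rw [ht, map_one]
  | succ n ih =>
    rw [pow_succ] at *
    obtain ⟨a, ha, b, hb, rfl⟩ := ht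
    simp only [map_mul]
    exact Set.mul_mem_mul (ih ha) (shift_mem_sing hb k)

/-- For a sequence of singular elements `a`, some partial product `p_g a_0 ⋯ a_n` vanishes: the
annihilators of the partial products in `S p_g` increase strictly as long as these are nonzero. -/
lemma exists_prod_eq_zero {g : G} [IsNoetherian S (I.P g)] (a : ℕ → S) (ha : ∀ n, a n ∈ I.sing)
    (c : ℕ → S) (hc0 : c 0 = I.p g) (hc : ∀ n, c (n + 1) = c n * a n) : ∃ n, c n = 0 := by
  have hmono : Monotone fun n => LinearMap.ker (I.ofP g (c n)) := by
    refine monotone_nat_of_le_succ fun n s hs => ?_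
    rw [LinearMap.mem_ker, ofP_apply, smul_eq_mul] at *
    rw [hc, ← mul_assoc, hs, zero_mul]
  obtain ⟨n, hn⟩ := monotone_stabilizes_iff_noetherian.2 ‹IsNoetherian S (I.P g)› ⟨_, hmono⟩
  have hleft : ∀ n, I.p g * c n = c n := fun n => by
    induction n with
    | zero => rw [hc0, I.mul_self]
    | succ n ih => rw [hc, ← mul_assoc, ih]
  have hright : ∀ n, ∃ h, c n ∈ I.P h := fun n => by
    cases n with
    | zero => exact ⟨g, hc0 ▸ I.p_mem_P g⟩
    | succ n =>
      obtain ⟨_, h, _, hah, _⟩ := ha n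
      exact ⟨h, hc n ▸ (I.P h).smul_mem _ hah⟩
  refine ⟨n, by_contra fun hne => ?_⟩
  obtain ⟨h, hh⟩ := hright n
  obtain ⟨s, hs, hs0, hsa⟩ := exists_mul_eq_zero_of_sing (ha n)
    (L := Submodule.span S {c n}) (by simpa using hh) (by simpa using hne)
  obtain ⟨t, rfl⟩ := Submodule.mem_span_singleton.1 hs
  have hmem : (⟨t * I.p g, I.mul_p_mem_P t g⟩ : I.P g) ∈ LinearMap.ker (I.ofP g (c (n + 1))) := by
    rw [LinearMap.mem_ker, ofP_apply, smul_eq_mul, hc, mul_assoc, ← mul_assoc (I.p g), hleft,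
      ← mul_assoc]
    exact hsa
  have heq : LinearMap.ker (I.ofP g (c n)) = LinearMap.ker (I.ofP g (c (n + 1))) :=
    hn (n + 1) n.le_succ
  rw [← heq, LinearMap.mem_ker, ofP_apply, smul_eq_mul, mul_assoc, hleft] at hmem
  exact hs0 hmem

variable (I) in
/-- The left annihilator of the products of `n` singular elements. -/
def annPow (n : ℕ) : Submodule S S where
  carrier := {s | ∀ t ∈ I.sing ^ n, s * t = 0}
  zero_mem' := by simp
  add_mem' ha hb t ht := by rw [add_mul, ha t ht, hb t ht, add_zero]
  smul_mem' r a ha t ht := by rw [smul_eq_mul, mul_assoc, ha t ht, mul_zero]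

lemma mem_annPow {n : ℕ} {s : S} : s ∈ I.annPow n ↔ ∀ t ∈ I.sing ^ n, s * t = 0 := Iff.rfl

lemma annPow_mono : Monotone I.annPow := by
  refine monotone_nat_of_le_succ fun n s hs t ht => ?_
  rw [pow_succ] at ht
  obtain ⟨a, ha, b, -, rfl⟩ := ht
  change s * (a * b) = 0
  rw [← mul_assoc, hs a ha, zero_mul]

lemma shift_mem_annPow {n : ℕ} {s : S} (hs : s ∈ I.annPow n) (k : G) :
    I.shift k s ∈ I.annPow n := by
  intro t ht
  rw [← I.shift_shift_neg k t, ← map_mul, hs _ (shift_mem_sing_pow ht _), map_zero]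

/-- The singular elements generate a nilpotent ideal. -/
theorem exists_le_annPow [∀ g, IsNoetherian S (I.P g)] : ∃ n, ∀ g, I.P g ≤ I.annPow n := by
  obtain ⟨n, hn⟩ := monotone_stabilizes_iff_noetherian.2 (inferInstanceAs (IsNoetherian S (I.P 0)))
    ⟨fun n => (I.annPow n).comap (I.P 0).subtype, fun m n hmn => Submodule.comap_mono
      (annPow_mono hmn)⟩
  have hstab : ∀ g, ∀ s ∈ I.P g, s ∈ I.annPow (n + 1) → s ∈ I.annPow n := by
    intro g s hs hsn
    have hs' : I.shift (-g) s ∈ I.P 0 := by simpa using I.shift_mem_P (-g) hs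
    have heq : (I.annPow n).comap (I.P 0).subtype = (I.annPow (n + 1)).comap (I.P 0).subtype :=
      hn (n + 1) n.le_succ
    have hmem : (⟨_, hs'⟩ : I.P 0) ∈ (I.annPow (n + 1)).comap (I.P 0).subtype :=
      shift_mem_annPow hsn (-g)
    rw [← heq] at hmem
    simpa [shift_shift_neg] using shift_mem_annPow hmem g
  refine ⟨n, fun g s hs => by_contra fun hsn => ?_⟩
  -- otherwise there is an infinite sequence of singular elements with nonzero partial products
  let X := {s : S // (∃ g, s ∈ I.P g) ∧ s ∉ I.annPow n}
  have hstep : ∀ x : X, ∃ a ∈ I.sing, (∃ g, x.1 * a ∈ I.P g) ∧ x.1 * a ∉ I.annPow n := by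
    rintro ⟨s, ⟨g, hs⟩, hsn⟩
    have h1 : s ∉ I.annPow (n + 1) := fun h => hsn (hstab g s hs h)
    rw [mem_annPow, pow_succ'] at h1
    push Not at h1
    obtain ⟨_, ⟨a, ha, b, hb, rfl⟩, hab⟩ := h1
    obtain ⟨_, h, _, hah, _⟩ := id ha
    exact ⟨a, ha, ⟨h, (I.P h).smul_mem s hah⟩, fun hmem => hab
      (by simpa [mul_assoc] using hmem b hb)⟩
  choose a ha hmem using hstep
  let x : ℕ → X := fun k => Nat.rec ⟨s, ⟨g, hs⟩, hsn⟩ (fun _ y => ⟨y.1 * a y, hmem y⟩) k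
  let c : ℕ → S := fun k => Nat.rec (I.p g) (fun k y => y * a (x k)) k
  obtain ⟨k, hk⟩ := exists_prod_eq_zero (g := g) (fun k => a (x k)) (fun k => ha _) c rfl
    fun _ => rfl
  have hx : ∀ k, (x k).1 = s * c k := fun k => by
    induction k with
    | zero => exact (I.mem_P.1 hs).symm
    | succ k ih =>
      change (x k).1 * a (x k) = s * (c k * a (x k))
      rw [ih, mul_assoc]
  exact (x k).2.2 (by rw [hx, hk, mul_zero]; exact zero_mem _)

/-! ### Existence of simple submodules -/

variable (I) in
/-- The submodule of `S p_g` generated by singular elements. -/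
def singP (g : G) : Submodule S (I.P g) := Submodule.span S {a | (a : S) ∈ I.sing}

lemma isInj_of_subsingleton {N : Type w} [AddCommGroup N] [Module S N] [Subsingleton N] :
    I.IsInj N := fun _ _ _ _ _ _ _ _ _ _ _ => ⟨0, fun _ => Subsingleton.elim _ _⟩

/-- Among the injective submodules of a submodule, there is a maximal one. -/
lemma exists_maximal_isInj {N : Type w} [AddCommGroup N] [Module S N] [IsNoetherian S N]
    (L : Submodule S N) : ∃ D ≤ L, I.IsInj D ∧ ∀ D' ≤ L, I.IsInj D' → D ≤ D' → D' ≤ D := by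
  obtain ⟨D, ⟨hDL, hD⟩, hmax⟩ := set_has_maximal_iff_noetherian.2 ‹IsNoetherian S N›
    {D : Submodule S N | D ≤ L ∧ I.IsInj D} ⟨⊥, bot_le, isInj_of_subsingleton⟩
  exact ⟨D, hDL, hD, fun D' hD'L hD' hle => by_contra fun hnot =>
    hmax D' ⟨hD'L, hD'⟩ (lt_of_le_not_ge hle hnot)⟩

/-- Modulo singular elements, `S p_g` is semisimple. -/
theorem isSemisimpleModule_quotient_singP [∀ g, IsNoetherian S (I.P g)]
    (hinj : ∀ g, I.IsInj (I.P g)) (g : G) : IsSemisimpleModule S (I.P g ⧸ I.singP g) := by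
  have key : ∀ L : Submodule S (I.P g), ∃ C, L ⊔ C = ⊤ ∧ L ⊓ C ≤ I.singP g := by
    intro L
    obtain ⟨D, hDL, hD, hmax⟩ := exists_maximal_isInj (I := I) L
    obtain ⟨C, hDC⟩ := hD.exists_isCompl
    refine ⟨C, eq_top_iff.2 (hDC.sup_eq_top.ge.trans (sup_le_sup_right hDL C)), ?_⟩
    refine I.le_of_homogeneous fun h a ha hah => by_contra fun hsing => ?_
    -- a nonsingular `a ∈ L ⊓ C` gives an injective submodule of `L ⊓ C`
    have hns : (a : S) ∉ I.sing := fun has => hsing (Submodule.subset_span has)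
    have hK : ∃ K ≤ I.P h, K ≠ ⊥ ∧ ∀ s ∈ K, s * (a : S) = 0 → s = 0 := by
      by_contra! hK
      refine hns ⟨h, g, by simpa using congrArg Subtype.val hah, a.2, fun L hL hL0 => ?_⟩
      obtain ⟨s, hs, h0, hne⟩ := hK L hL hL0
      exact ⟨s, hs, hne, h0⟩
    obtain ⟨K, hKP, hK0, hKa⟩ := hK
    obtain ⟨D', C', hKD', hDC', hess⟩ := (hinj h).exists_hull (K.comap (I.P h).subtype)
    have hker : Disjoint D' (LinearMap.ker (I.ofP h a)) := by
      rw [disjoint_iff]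
      refine hess _ inf_le_left (Submodule.disjoint_def.2 fun s hs hsK => ?_)
      exact Subtype.ext (hKa s hsK (congrArg Subtype.val (LinearMap.mem_ker.1 hs.2)))
    have hle : D'.map (I.ofP h a) ≤ L ⊓ C := by
      rintro _ ⟨s, -, rfl⟩
      exact (L ⊓ C).smul_mem _ ha
    have hinjmap : I.IsInj (D'.map (I.ofP h a)) :=
      ((hinj h).of_isCompl hDC').map _ hker
    have hsup := hmax _ (sup_le hDL (hle.trans inf_le_left))
      (hD.sup hinjmap (hDC.disjoint.mono_right (hle.trans inf_le_right))) le_sup_left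
    have hbot : D'.map (I.ofP h a) = ⊥ :=
      eq_bot_iff.2 (hDC.disjoint (le_sup_right.trans hsup) (hle.trans inf_le_right))
    refine hK0 (eq_bot_iff.2 fun s hs => ?_)
    have hsD : (⟨s, hKP hs⟩ : I.P h) ∈ D' := hKD' hs
    have : I.ofP h a ⟨s, hKP hs⟩ = 0 := by
      rw [← Submodule.mem_bot S, ← hbot]
      exact ⟨_, hsD, rfl⟩
    exact hKa s hs (congrArg Subtype.val this)
  refine (isSemisimpleModule_iff S _).2 ⟨fun L => ?_⟩
  obtain ⟨C, hsup, hinf⟩ := key (L.comap (I.singP g).mkQ)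
  refine ⟨C.map (I.singP g).mkQ, ?_, ?_⟩
  · refine Submodule.disjoint_def.2 ?_
    rintro _ hx ⟨c, hc, rfl⟩
    exact (Submodule.Quotient.mk_eq_zero _).2 (hinf ⟨hx, hc⟩)
  · rw [codisjoint_iff, ← Submodule.map_comap_eq_of_surjective (I.singP g).mkQ_surjective L,
      ← Submodule.map_sup, hsup, Submodule.map_top, Submodule.range_mkQ]

/-- Every nonzero rational module has a simple submodule. -/
theorem exists_isSimpleModule [∀ g, IsNoetherian S (I.P g)] (hinj : ∀ g, I.IsInj (I.P g))
    (N : Type v) [AddCommGroup N] [Module S N] [I.Rational N] [Nontrivial N] :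
    ∃ L : Submodule S N, IsSimpleModule S L := by
  have key : ∀ (n : ℕ) (g : G) (x : N), I.p g • x = x → x ≠ 0 → (∀ t ∈ I.sing ^ n, t • x = 0) →
      ∃ L : Submodule S N, IsSimpleModule S L := by
    intro n
    induction n with
    | zero =>
      intro g x _ hx0 hx
      exact absurd (by simpa using hx 1 (by simp)) hx0
    | succ n ih =>
      intro g x hgx hx0 hx
      by_cases hkill : ∃ a ∈ I.sing, a • x ≠ 0
      · obtain ⟨a, ha, hax⟩ := hkill
        obtain ⟨k, _, hka, _⟩ := id ha
        refine ih k (a • x) (by rw [smul_smul, hka]) hax fun t ht => ?_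
        rw [smul_smul]
        exact hx _ (by rw [pow_succ]; exact Set.mul_mem_mul ht ha)
      · push Not at hkill
        have := isSemisimpleModule_quotient_singP hinj g
        let f : (I.P g ⧸ I.singP g) →ₗ[S] N := (I.singP g).liftQ (I.ofP g x)
          (Submodule.span_le.2 fun a ha => hkill a ha)
        have hr := IsSemisimpleModule.range f
        have hne : LinearMap.range f ≠ ⊥ := by
          intro h
          have hmem : f (Submodule.Quotient.mk ⟨I.p g, I.p_mem_P g⟩) ∈ LinearMap.range f := ⟨_, rfl⟩
          rw [h, Submodule.mem_bot] at hmem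
          exact hx0 (hgx ▸ hmem)
        rcases IsSemisimpleModule.eq_bot_or_exists_simple_le (LinearMap.range f) with h | ⟨m, -, hm⟩
        · exact absurd h hne
        · exact ⟨m, hm⟩
  obtain ⟨n, hn⟩ := exists_le_annPow (I := I)
  obtain ⟨x, hx⟩ := exists_ne (0 : N)
  obtain ⟨g, hg⟩ := I.exists_p_smul_ne_zero hx
  refine key n g _ (I.p_smul_p_smul_self g x) hg fun t ht => ?_
  by_contra hne
  obtain ⟨h, hh⟩ := I.exists_p_smul_ne_zero hne
  rw [smul_smul, hn h (I.p_mem_P h) t ht, zero_smul] at hh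
  exact hh rfl

end IdempotentSystem

namespace IdempotentSystem

variable {G : Type u} [AddGroup G] {S : Type w} [Ring S] (I : IdempotentSystem G S)

/-! ### Every simple module embeds into a translate of `S p_0` -/

/-- Two modules are translates of each other, up to isomorphism. -/
def TwEquiv (T T' : Type w) [AddCommGroup T] [Module S T] [AddCommGroup T'] [Module S T'] : Prop :=
  ∃ k, Nonempty (T ≃ₗ[S] I.Tw k T')

/-- `T` is a nonzero quotient of an injective and projective module in which `A` is contained in
every nonzero submodule. For simple modules `A` and `T`, this says that the injective hull of `A` is
projective and that `T` is a simple quotient of it. -/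
def IsTopOfHull (A T : Type w) [AddCommGroup A] [Module S A] [AddCommGroup T] [Module S T] : Prop :=
  ∃ (Q : Type w) (_ : AddCommGroup Q) (_ : Module S Q), I.Rational Q ∧ I.IsInj Q ∧ I.IsProj Q ∧
    (∃ i : A →ₗ[S] Q, Function.Injective i ∧ ∀ L : Submodule S Q, L ≠ ⊥ → LinearMap.range i ≤ L) ∧
    ∃ f : Q →ₗ[S] T, f ≠ 0

variable {I}

section

variable {T T' T'' : Type w} [AddCommGroup T] [Module S T] [AddCommGroup T'] [Module S T']
  [AddCommGroup T''] [Module S T'']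

lemma TwEquiv.of_equiv (e : T ≃ₗ[S] T') : I.TwEquiv T T' := ⟨0, ⟨e.trans (I.twZero T').symm⟩⟩

lemma TwEquiv.symm (h : I.TwEquiv T T') : I.TwEquiv T' T := by
  obtain ⟨k, ⟨e⟩⟩ := h
  exact ⟨-k, ⟨(I.twNegTw k T').symm.trans (I.twCongr (-k) e.symm)⟩⟩

lemma TwEquiv.trans (h : I.TwEquiv T T') (h' : I.TwEquiv T' T'') : I.TwEquiv T T'' := by
  obtain ⟨k, ⟨e⟩⟩ := h
  obtain ⟨l, ⟨e'⟩⟩ := h'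
  exact ⟨k + l, ⟨(e.trans (I.twCongr k e')).trans (I.twTw k l)⟩⟩

lemma twEquiv_tw (k : G) : I.TwEquiv T (I.Tw k T) := ⟨-k, ⟨(I.twNegTw k T).symm⟩⟩

end

section

variable {N : Type w} [AddCommGroup N] [Module S N]

variable (I) in
/-- A submodule of a translate, as a submodule of the original module. -/
def untw {k : G} (L : Submodule S (I.Tw k N)) : Submodule S N where
  carrier := {x | I.toTw k N x ∈ L}
  zero_mem' := by simp
  add_mem' ha hb := L.add_mem ha hb
  smul_mem' s x hx := by
    change I.toTw k N (s • x) ∈ L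
    rw [toTw_smul]
    exact L.smul_mem _ hx

variable (I) in
lemma mem_untw {k : G} {L : Submodule S (I.Tw k N)} {x : N} :
    x ∈ I.untw L ↔ I.toTw k N x ∈ L := Iff.rfl

variable (I) in
/-- A submodule of a translate is the translate of a submodule. -/
def untwEquiv {k : G} (L : Submodule S (I.Tw k N)) : L ≃ₗ[S] I.Tw k (I.untw L) where
  toFun x := I.toTw k (I.untw L) ⟨(I.toTw k N).symm x, by simp [mem_untw]⟩
  invFun x := ⟨I.toTw k N ((I.toTw k (I.untw L)).symm x : I.untw L),
    ((I.toTw k (I.untw L)).symm x).2⟩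
  map_add' _ _ := rfl
  map_smul' _ _ := rfl
  left_inv _ := rfl
  right_inv _ := rfl

end

section

variable {A A' T T' : Type w} [AddCommGroup A] [Module S A] [AddCommGroup A'] [Module S A']
  [AddCommGroup T] [Module S T] [AddCommGroup T'] [Module S T']

lemma IsTopOfHull.of_equiv (h : I.IsTopOfHull A T) (e : A' ≃ₗ[S] A) : I.IsTopOfHull A' T := by
  obtain ⟨Q, _, _, hQ, hinj, hproj, ⟨i, hi, hL⟩, f⟩ := h
  refine ⟨Q, _, _, hQ, hinj, hproj, ⟨i.comp e.toLinearMap, hi.comp e.injective, fun L h0 => ?_⟩, f⟩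
  exact (LinearMap.range_comp_le_range _ _).trans (hL L h0)

lemma IsTopOfHull.tw (h : I.IsTopOfHull A T) (k : G) : I.IsTopOfHull (I.Tw k A) (I.Tw k T) := by
  obtain ⟨Q, _, _, hQ, hinj, hproj, ⟨i, hi, hL⟩, f, hf⟩ := h
  refine ⟨I.Tw k Q, _, _, inferInstance, hinj.tw k, hproj.tw k,
    ⟨I.twMap k i, fun _ _ h => hi h, fun L h0 => ?_⟩, I.twMap k f, fun h => hf ?_⟩
  · have h0' : I.untw L ≠ ⊥ := by
      obtain ⟨x, hx, hx0⟩ := Submodule.exists_mem_ne_zero_of_ne_bot h0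
      exact fun h => hx0 ((Submodule.eq_bot_iff _).1 h ((I.toTw k Q).symm x) hx)
    rintro _ ⟨x, rfl⟩
    exact hL _ h0' ⟨_, rfl⟩
  · ext x
    exact LinearMap.congr_fun h (I.toTw k Q x)

/-- A monomorphism from a nonzero injective module to a module in which any two nonzero submodules
meet is an isomorphism. -/
lemma IsInj.surjective_of_injective {Q Q' : Type w} [AddCommGroup Q] [Module S Q]
    [AddCommGroup Q'] [Module S Q'] [I.Rational Q'] [Nontrivial Q] (hQ : I.IsInj Q)
    [Nontrivial A] (i : A →ₗ[S] Q') (hi : Function.Injective i)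
    (hL : ∀ L : Submodule S Q', L ≠ ⊥ → LinearMap.range i ≤ L)
    (φ : Q →ₗ[S] Q') (hφ : Function.Injective φ) : Function.Surjective φ := by
  obtain ⟨C, hC⟩ := (hQ.of_equiv (LinearEquiv.ofInjective φ hφ).symm).exists_isCompl
  have hr : LinearMap.range φ ≠ ⊥ := by
    obtain ⟨x, hx⟩ := exists_ne (0 : Q)
    exact fun h => hx (hφ (by simpa using LinearMap.congr_fun (LinearMap.range_eq_bot.1 h) x))
  have hCbot : C = ⊥ := by
    by_contra hC0
    obtain ⟨a, ha⟩ := exists_ne (0 : A)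
    have := Submodule.disjoint_def.1 hC.disjoint (i a) (hL _ hr ⟨a, rfl⟩) (hL _ hC0 ⟨a, rfl⟩)
    exact ha (hi (by simpa using this))
  rw [← LinearMap.range_eq_top]
  simpa [hCbot] using hC.sup_eq_top

/-- An injective and projective module in which any two nonzero submodules meet has at most one
simple quotient: its endomorphism ring is local. -/
lemma IsProj.nonempty_equiv_of_ne_zero {Q : Type w} [AddCommGroup Q] [Module S Q]
    [I.Rational Q] (hQ : I.IsInj Q) (hQ' : I.IsProj Q) [Nontrivial A] (i : A →ₗ[S] Q)
    (hi : Function.Injective i) (hL : ∀ L : Submodule S Q, L ≠ ⊥ → LinearMap.range i ≤ L)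
    [IsSimpleModule S T] [IsSimpleModule S T'] {f : Q →ₗ[S] T} (hf : f ≠ 0) {f' : Q →ₗ[S] T'}
    (hf' : f' ≠ 0) : Nonempty (T ≃ₗ[S] T') := by
  have hsurj := LinearMap.surjective_of_ne_zero hf
  have hsurj' := LinearMap.surjective_of_ne_zero hf'
  have hco := LinearMap.isCoatom_ker_of_surjective hsurj
  have hco' := LinearMap.isCoatom_ker_of_surjective hsurj'
  by_cases heq : LinearMap.ker f = LinearMap.ker f'
  · exact ⟨((f.quotKerEquivOfSurjective hsurj).symm.trans (Submodule.quotEquivOfEq _ _ heq)).trans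
      (f'.quotKerEquivOfSurjective hsurj')⟩
  exfalso
  have hsup : LinearMap.ker f ⊔ LinearMap.ker f' = ⊤ := hco.sup_eq_top_of_ne hco' heq
  have hsurj'' : Function.Surjective (f.comp (LinearMap.ker f').subtype) := by
    intro t
    obtain ⟨x, rfl⟩ := hsurj t
    obtain ⟨a, ha, b, hb, rfl⟩ := Submodule.mem_sup.1 (hsup ▸ Submodule.mem_top : x ∈ _ ⊔ _)
    exact ⟨⟨b, hb⟩, by simp [LinearMap.mem_ker.1 ha]⟩
  have : I.Rational T := I.rational_of_surjective f hsurj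
  obtain ⟨e, he⟩ := hQ' (LinearMap.ker f') T _ hsurj'' f
  -- the endomorphisms `e` and `1 - e` are not surjective, but one of them is injective
  let e₁ : Q →ₗ[S] Q := (LinearMap.ker f').subtype.comp e
  have hfe : ∀ x, f (e₁ x) = f x := he
  have hfe' : ∀ x, f' (e₁ x) = 0 := fun x => LinearMap.mem_ker.1 (e x).2
  obtain ⟨a, ha⟩ := exists_ne (0 : A)
  have : Nontrivial Q := ⟨i a, 0, fun h => ha (hi (by simpa using h))⟩
  have hinj : Function.Injective e₁ ∨ Function.Injective (LinearMap.id - e₁ : Q →ₗ[S] Q) := by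
    by_contra! h
    simp only [← LinearMap.ker_eq_bot] at h
    have h1 : e₁ (i a) = 0 := hL _ h.1 ⟨a, rfl⟩
    have h2 : i a - e₁ (i a) = 0 := hL _ h.2 ⟨a, rfl⟩
    rw [h1, sub_zero] at h2
    exact ha (hi (by simpa using h2))
  rcases hinj with h | h
  · have hs := hQ.surjective_of_injective i hi hL _ h
    refine hf' (LinearMap.ext fun x => ?_)
    obtain ⟨y, rfl⟩ := hs x
    exact hfe' y
  · have hs := hQ.surjective_of_injective i hi hL _ h
    refine hf (LinearMap.ext fun x => ?_)
    obtain ⟨y, rfl⟩ := hs x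
    simp [hfe]

lemma IsTopOfHull.nonempty_equiv [IsSimpleModule S A] [IsSimpleModule S T] [IsSimpleModule S T']
    (h : I.IsTopOfHull A T) (h' : I.IsTopOfHull A T') : Nonempty (T ≃ₗ[S] T') := by
  obtain ⟨Q, _, _, hQ, hinj, hproj, ⟨i, hi, hL⟩, f, hf⟩ := h
  obtain ⟨Q', _, _, hQ', hinj', hproj', ⟨i', hi', hL'⟩, f', hf'⟩ := h'
  have hA := IsSimpleModule.nontrivial S A
  obtain ⟨a, ha⟩ := exists_ne (0 : A)
  have : I.Rational A := I.rational_of_injective i hi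
  obtain ⟨φ, hφ⟩ := hinj' A Q i hi i'
  have hφinj : Function.Injective φ := by
    rw [← LinearMap.ker_eq_bot]
    by_contra h0
    have : φ (i a) = 0 := hL _ h0 ⟨a, rfl⟩
    rw [hφ] at this
    exact ha (hi' (by simpa using this))
  have : Nontrivial Q := ⟨i a, 0, fun h => ha (hi (by simpa using h))⟩
  have hφsurj := hinj.surjective_of_injective i' hi' hL' φ hφinj
  refine hproj.nonempty_equiv_of_ne_zero hinj i hi hL hf (f' := f'.comp φ) fun h => hf' ?_
  ext x
  obtain ⟨y, rfl⟩ := hφsurj x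
  exact LinearMap.congr_fun h y

lemma IsTopOfHull.twEquiv [IsSimpleModule S A] [IsSimpleModule S T] [IsSimpleModule S T']
    (h : I.IsTopOfHull A T) (h' : I.IsTopOfHull A' T') (hA : I.TwEquiv A A') :
    I.TwEquiv T T' := by
  obtain ⟨k, ⟨e⟩⟩ := hA
  have := (I.isSimpleModule_Tw_iff k).2 ‹IsSimpleModule S T'›
  exact ⟨k, h.nonempty_equiv ((h'.tw k).of_equiv e)⟩

end

/-- Every simple rational module is, up to translation, the simple quotient of the injective hull
of a simple submodule of `S p_0`. -/
theorem exists_isTopOfHull [∀ g, IsNoetherian S (I.P g)] (hinj : ∀ g, I.IsInj (I.P g))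
    (T : Type w) [AddCommGroup T] [Module S T] [I.Rational T] [IsSimpleModule S T] :
    ∃ A : Submodule S (I.P 0), IsSimpleModule S A ∧ ∃ k, I.IsTopOfHull A (I.Tw k T) := by
  have hT := IsSimpleModule.nontrivial S T
  obtain ⟨t, ht⟩ := exists_ne (0 : T)
  obtain ⟨g, hg⟩ := I.exists_p_smul_ne_zero ht
  let f : I.P g →ₗ[S] T := I.ofP g t
  obtain ⟨D, hDM, hD, hmax⟩ := exists_maximal_isInj (I := I) (LinearMap.ker f)
  obtain ⟨C, hDC⟩ := hD.exists_isCompl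
  have hC : Nontrivial C := by
    rw [Submodule.nontrivial_iff_ne_bot]
    rintro rfl
    have h1 : (⟨I.p g, I.p_mem_P g⟩ : I.P g) ∈ D := by
      rw [eq_top_of_isCompl_bot hDC]
      trivial
    exact hg (hDM h1)
  obtain ⟨B', hB'⟩ := exists_isSimpleModule hinj C
  let B : Submodule S (I.P g) := B'.map C.subtype
  have hCinj : I.IsInj C := (hinj g).of_isCompl hDC.symm
  obtain ⟨Q', E', hBQ', hQE', hess'⟩ := hCinj.exists_hull B'
  have hQ'inj : I.IsInj Q' := hCinj.of_isCompl hQE'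
  have hQ'proj : I.IsProj Q' := ((I.isProj_P g).of_isCompl hDC.symm).of_isCompl hQE'
  have htop : I.IsTopOfHull B' T := by
    refine ⟨Q', _, _, inferInstance, hQ'inj, hQ'proj,
      ⟨Submodule.inclusion hBQ', Submodule.inclusion_injective _, fun L hL0 => ?_⟩,
      (f.comp C.subtype).comp Q'.subtype, fun h0 => ?_⟩
    · have hLB : (L.map Q'.subtype) ⊓ B' ≠ ⊥ := fun h => by
        have := hess' _ (Submodule.map_subtype_le Q' L) (disjoint_iff.2 h)
        exact hL0 (Submodule.map_injective_of_injective Q'.injective_subtype (by simpa using this))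
      have hle : B' ≤ L.map Q'.subtype := by
        have := ((isSimpleModule_iff_isAtom.1 hB').le_iff.1 inf_le_right).resolve_left hLB
        exact inf_eq_right.1 this
      rintro _ ⟨b, rfl⟩
      obtain ⟨y, hy, hyb⟩ := hle b.2
      have : Submodule.inclusion hBQ' b = y := Subtype.ext hyb.symm
      rwa [this]
    · -- if `f` vanishes on the hull, then the maximal injective submodule of its kernel can be
      -- enlarged
      have hle : Q'.map C.subtype ≤ LinearMap.ker f := by
        rintro _ ⟨x, hx, rfl⟩
        exact LinearMap.congr_fun h0 ⟨x, hx⟩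
      have hleC : Q'.map C.subtype ≤ C := Submodule.map_subtype_le _ _
      have h1 := hmax _ (sup_le hDM hle) (hD.sup (hQ'inj.map C.subtype (by simp))
        (hDC.disjoint.mono_right hleC)) le_sup_left
      have h2 : Q'.map C.subtype = ⊥ :=
        eq_bot_iff.2 (hDC.disjoint (le_sup_right.trans h1) hleC)
      have h3 : Q' = ⊥ := Submodule.map_injective_of_injective C.injective_subtype (by simpa using h2)
      exact (isSimpleModule_iff_isAtom.1 hB').1 (eq_bot_iff.2 (h3 ▸ hBQ'))
  let L : Submodule S (I.Tw (-g) (I.P 0)) := B.map (I.PEquivTw g).toLinearMap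
  let e : B' ≃ₗ[S] I.Tw (-g) (I.untw L) :=
    ((Submodule.equivMapOfInjective _ C.injective_subtype B').trans
      (Submodule.equivMapOfInjective _ (I.PEquivTw g).injective B)).trans (I.untwEquiv L)
  have hA : IsSimpleModule S (I.untw L) := (I.isSimpleModule_Tw_iff (-g)).1 (hB'.congr e.symm)
  refine ⟨I.untw L, hA, g, (htop.tw g).of_equiv ?_⟩
  exact ((I.twCongr g e).trans (I.twTwNeg g _)).symm

end IdempotentSystem

lemma sSupIndep.insert {α : Type*} [CompleteLattice α] [IsModularLattice α] {s : Set α}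
    (hs : sSupIndep s) {q : α} (hq : Disjoint (sSup s) q) : sSupIndep (insert q s) := by
  have hq' : Disjoint q (sSup (Insert.insert q s \ {q})) :=
    hq.symm.mono_right (sSup_le_sSup (by simp))
  rintro a (rfl | ha)
  · exact hq'
  by_cases haq : a = q
  · exact haq ▸ hq'
  · refine ((hs ha).disjoint_sup_right_of_disjoint_sup_left (hq.mono_left
      (sup_le (le_sSup ha) (sSup_le_sSup Set.sdiff_subset)))).mono_right (sSup_le ?_)
    rintro b ⟨rfl | hb, hba⟩
    · exact le_sup_right
    · exact le_sup_of_le_left (le_sSup ⟨hb, hba⟩)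

namespace IdempotentSystem

variable {G : Type u} [AddGroup G] {S : Type w} [Ring S] {I : IdempotentSystem G S}

/-- Every simple rational module is a translate of a simple submodule of `S p_0`. By Noetherianity,
the simple submodules of `S p_0` fall into finitely many classes. Sending the class of `T` to the
class of an `A` such that `T` is the simple quotient of the injective hull of `A` is injective on
all simple rational modules, hence surjective on the classes of simple submodules of `S p_0`. -/
theorem exists_twEquiv_submodule [∀ g, IsNoetherian S (I.P g)] (hinj : ∀ g, I.IsInj (I.P g))
    (T : Type w) [AddCommGroup T] [Module S T] [I.Rational T] [IsSimpleModule S T] :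
    ∃ A : Submodule S (I.P 0), IsSimpleModule S A ∧ I.TwEquiv T A := by
  let X := {A : Submodule S (I.P 0) // IsSimpleModule S A}
  have hX : ∀ A : X, IsSimpleModule S A.1 := fun A => A.2
  let s : Setoid X :=
    { r := fun A B => I.TwEquiv A.1 B.1
      iseqv := ⟨fun A => .of_equiv (LinearEquiv.refl S _), fun h => h.symm, fun h h' => h.trans h'⟩ }
  have hfin : Finite (Quotient s) := by
    let c : Quotient s → isotypicComponents S (I.P 0) := fun q =>
      ⟨isotypicComponent S (I.P 0) q.out.1, q.out.1, q.out.2, rfl⟩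
    refine Finite.of_injective c fun q q' h => ?_
    have h' : isotypicComponent S (I.P 0) q.out.1 = isotypicComponent S (I.P 0) q'.out.1 :=
      congrArg Subtype.val h
    obtain ⟨e⟩ := isIsotypicOfType_submodule_iff.mp
      (IsIsotypicOfType.isotypicComponent S (I.P 0) q'.out.1) q.out.1
      (h' ▸ q.out.1.le_isotypicComponent)
    rw [← q.out_eq, ← q'.out_eq]
    exact Quotient.sound (TwEquiv.of_equiv e)
  have hF : ∀ A : X, ∃ B : X, ∃ k, I.IsTopOfHull B.1 (I.Tw k A.1) := fun A => by
    obtain ⟨B, hB, k, h⟩ := exists_isTopOfHull hinj A.1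
    exact ⟨⟨B, hB⟩, k, h⟩
  choose F k hFk using hF
  have hclass : ∀ (T' : Type w) [AddCommGroup T'] [Module S T'] [IsSimpleModule S T'] (B : X) (l : G)
      (A : X), I.IsTopOfHull B.1 (I.Tw l T') → I.TwEquiv B.1 (F A).1 → I.TwEquiv T' A.1 := by
    intro T' _ _ _ B l A hB h
    have h1 : IsSimpleModule S (I.Tw l T') := (I.isSimpleModule_Tw_iff l).2 inferInstance
    have h2 : IsSimpleModule S (I.Tw (k A) A.1) := (I.isSimpleModule_Tw_iff (k A)).2 inferInstance
    exact (twEquiv_tw l).trans ((hB.twEquiv (hFk A) h).trans (twEquiv_tw (k A)).symm)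
  let φ : Quotient s → Quotient s := fun q => ⟦F q.out⟧
  have hφ : Function.Injective φ := fun q q' h => by
    rw [← q.out_eq, ← q'.out_eq]
    exact Quotient.sound (hclass q.out.1 _ _ _ (hFk q.out) (Quotient.exact h))
  obtain ⟨B, hB, l, hBT⟩ := exists_isTopOfHull hinj T
  obtain ⟨q, hq⟩ := Finite.injective_iff_surjective.1 hφ ⟦⟨B, hB⟩⟧
  exact ⟨q.out.1, q.out.2, hclass T ⟨B, hB⟩ l q.out hBT (Setoid.symm (Quotient.exact hq))⟩

/-! ### Injective modules are projective -/

/-- A nonzero injective rational module contains a nonzero submodule that is injective and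
projective: the injective hull of a simple submodule, which is a summand of a translate of `S p_0`. -/
lemma IsInj.exists_isInj_isProj [∀ g, IsNoetherian S (I.P g)] (hinj : ∀ g, I.IsInj (I.P g))
    {E : Type w} [AddCommGroup E] [Module S E] [I.Rational E] [Nontrivial E] (hE : I.IsInj E) :
    ∃ Q : Submodule S E, Q ≠ ⊥ ∧ I.IsInj Q ∧ I.IsProj Q := by
  obtain ⟨T, hT⟩ := exists_isSimpleModule hinj E
  obtain ⟨A, hA, k, ⟨e⟩⟩ := exists_twEquiv_submodule hinj T
  have hU : I.IsInj (I.Tw k (I.P 0)) := (hinj 0).tw k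
  let j : T →ₗ[S] I.Tw k (I.P 0) := (I.twMap k A.subtype).comp e.toLinearMap
  have hj : Function.Injective j := fun x y h =>
    e.injective ((I.toTw k A).symm.injective (A.injective_subtype ((I.toTw k (I.P 0)).injective h)))
  obtain ⟨D, C, hAD, hDC, hess⟩ := hU.exists_hull (LinearMap.range j)
  let j' : T →ₗ[S] D := j.codRestrict D fun x => hAD ⟨x, rfl⟩
  have hj' : Function.Injective j' := fun x y h =>
    hj (congrArg D.subtype h)
  obtain ⟨f, hf⟩ := hE T D j' hj' T.subtype
  have hfinj : Function.Injective f := by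
    rw [← LinearMap.ker_eq_bot]
    refine Submodule.map_injective_of_injective D.injective_subtype ?_
    rw [Submodule.map_bot]
    refine hess _ (Submodule.map_subtype_le D _) (Submodule.disjoint_def.2 ?_)
    rintro _ ⟨x, hx, rfl⟩ ⟨t, ht⟩
    obtain rfl : j' t = x := Subtype.ext ht
    have h0 : f (j' t) = 0 := hx
    rw [hf] at h0
    have : t = 0 := Subtype.ext h0
    simp [this]
  let eD : LinearMap.range f ≃ₗ[S] D := (LinearEquiv.ofInjective f hfinj).symm
  refine ⟨LinearMap.range f, fun h => ?_, (hU.of_isCompl hDC).of_equiv eD,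
    (((I.isProj_P 0).tw k).of_isCompl hDC).of_equiv eD⟩
  refine (isSimpleModule_iff_isAtom.1 hT).1 ((Submodule.eq_bot_iff _).2 fun x hx => ?_)
  have := hf ⟨x, hx⟩
  rw [LinearMap.range_eq_bot.1 h] at this
  exact this.symm

/-- The sum of an independent family of submodules is their direct sum. -/
noncomputable def equivSSupOfIndep {N : Type w} [AddCommGroup N] [Module S N] (s : Set (Submodule S N))
    (hs : sSupIndep s) : (sSup s : Submodule S N) ≃ₗ[S] DirectSum s fun Q => Q.1 := by
  classical
  have hinj : Function.Injective (DirectSum.coeLinearMap fun Q : s => Q.1) :=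
    iSupIndep.dfinsupp_lsum_injective ((sSupIndep_iff _).1 hs)
  exact ((LinearEquiv.ofInjective _ hinj).trans (LinearEquiv.ofEq _ _
    (by rw [DirectSum.range_coeLinearMap, sSup_eq_iSup']))).symm

/-- An injective rational module is the direct sum of a maximal independent family of injective and
projective submodules. -/
theorem IsInj.isProj [∀ g, IsNoetherian S (I.P g)] (hinj : ∀ g, I.IsInj (I.P g))
    {E : Type w} [AddCommGroup E] [Module S E] [I.Rational E] (hE : I.IsInj E) : I.IsProj E := by
  obtain ⟨s, -, ⟨hs, hsQ⟩, hmax⟩ := zorn_subset_nonempty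
    {s : Set (Submodule S E) | sSupIndep s ∧ ∀ Q ∈ s, I.IsInj Q ∧ I.IsProj Q}
    (fun c hc hchain _ => ⟨⋃₀ c,
      ⟨iSupIndep_sUnion_of_directed hchain.directedOn fun a ha => (hc ha).1,
        fun Q ⟨a, ha, hQ⟩ => (hc ha).2 Q hQ⟩, fun a ha => Set.subset_sUnion_of_mem ha⟩) ∅
    ⟨sSupIndep_empty, by simp⟩
  have e := equivSSupOfIndep s hs
  have hD : I.IsInj (sSup s : Submodule S E) :=
    (isInj_directSum (fun Q : s => Q.1) fun Q => (hsQ Q.1 Q.2).1).of_equiv e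
  have hD' : I.IsProj (sSup s : Submodule S E) :=
    (isProj_directSum (fun Q : s => Q.1) fun Q => (hsQ Q.1 Q.2).2).of_equiv e
  obtain ⟨C, hC⟩ := hD.exists_isCompl
  have hC0 : C = ⊥ := by
    by_contra hC0
    have : Nontrivial C := Submodule.nontrivial_iff_ne_bot.2 hC0
    obtain ⟨Q', hQ0', hQi, hQp⟩ := (hE.of_isCompl hC.symm).exists_isInj_isProj hinj
    let Q := Q'.map C.subtype
    let eQ : Q ≃ₗ[S] Q' := (Submodule.equivMapOfInjective _ C.injective_subtype Q').symm
    have hQC : Q ≤ C := Submodule.map_subtype_le _ _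
    have hQ0 : Q ≠ ⊥ := fun h =>
      hQ0' (Submodule.map_injective_of_injective C.injective_subtype (by simpa using h))
    have hQs : Q ∈ s := by
      refine hmax (y := insert Q s) ⟨?_, ?_⟩ (Set.subset_insert Q s) (Set.mem_insert Q s)
      · exact hs.insert (hC.disjoint.mono_right hQC)
      · rintro _ (rfl | h)
        · exact ⟨hQi.of_equiv eQ, hQp.of_equiv eQ⟩
        · exact hsQ _ h
    exact hQ0 (eq_bot_iff.2 (hC.disjoint (le_sSup hQs) hQC))
  have htop : sSup s = ⊤ := eq_top_of_isCompl_bot (hC0 ▸ hC)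
  exact hD'.of_equiv ((LinearEquiv.ofTop _ htop).symm)

end IdempotentSystem

namespace IdempotentSystem

variable {G : Type u} [AddGroup G] {S : Type w} [Ring S] {I : IdempotentSystem G S}

/-! ### Noetherianity from the coincidence of injective and projective modules -/

/-- There are enough injective rational modules: take the rational part of an injective module. -/
theorem exists_isInj_embedding (I : IdempotentSystem G S) (N : Type w) [AddCommGroup N]
    [Module S N] [I.Rational N] :
    ∃ (E : Type w) (_ : AddCommGroup E) (_ : Module S E) (_ : I.Rational E) (i : N →ₗ[S] E),
      I.IsInj E ∧ Function.Injective i := by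
  obtain ⟨⟨J, hJ, f, hf⟩⟩ := CategoryTheory.EnoughInjectives.presentation (ModuleCat.of S N)
  have hJ' : Module.Injective S J := Module.injective_module_of_injective_object S J
  have hfinj : Function.Injective f.hom := (ModuleCat.mono_iff_injective f).1 hf
  refine ⟨I.rationalPart J, inferInstance, inferInstance, inferInstance,
    f.hom.codRestrict _ fun x => I.map_mem_rationalPart (N' := N) f.hom x, ?_,
    fun x y h => hfinj (congrArg Subtype.val h)⟩
  intro X Y _ _ _ _ _ _ k hk g
  obtain ⟨h, hh⟩ := Module.Injective.out k hk ((I.rationalPart J).subtype.comp g)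
  exact ⟨h.codRestrict _ fun y => I.map_mem_rationalPart h y, fun x => Subtype.ext (hh x)⟩

/-- If the injective and the projective rational modules coincide, then `S p_g` is Noetherian:
direct sums of injective modules are injective, being direct sums of projective modules. Given an
ascending chain `L n` with union `L`, a map `L → ⨁ E n` with kernels `L n` to injective modules
`E n` therefore extends to `S p_g`, and the image of `p_g` has only finitely many nonzero
components. -/
theorem isNoetherian_of_isInj_iff_isProj
    (h : ∀ (N : Type w) [AddCommGroup N] [Module S N] [I.Rational N], I.IsInj N ↔ I.IsProj N)
    (g : G) : IsNoetherian S (I.P g) := by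
  classical
  refine monotone_stabilizes_iff_noetherian.1 fun L => ?_
  choose E hE₁ hE₂ hE₃ i hi hinj using fun n : ULift.{w} ℕ =>
    I.exists_isInj_embedding (I.P g ⧸ L n.down)
  have hsum : I.IsInj (DirectSum (ULift.{w} ℕ) E) :=
    (h _).2 (isProj_directSum E fun n => (h _).1 (hi n))
  let U : Submodule S (I.P g) := ⨆ n, L n
  have hU : ∀ x ∈ U, ∃ n, x ∈ L n := fun x hx =>
    (Submodule.mem_iSup_of_directed _ L.monotone.directed_le).1 hx
  let φ : I.P g →ₗ[S] ∀ n, E n := LinearMap.pi fun n => (i n).comp (L n.down).mkQ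
  have hφ : ∀ n x, x ∈ L n ↔ φ x ⟨n⟩ = 0 := fun n x => by
    change _ ↔ i ⟨n⟩ ((L n).mkQ x) = 0
    rw [map_eq_zero_iff _ (hinj ⟨n⟩)]
    exact (Submodule.Quotient.mk_eq_zero _).symm
  let c : DirectSum (ULift.{w} ℕ) E →ₗ[S] ∀ n, E n := DirectSum.coeFnLinearMap S
  have hc : Function.Injective c := DFunLike.coe_injective
  have hrange : ∀ x : U, φ x ∈ LinearMap.range c := by
    rintro ⟨x, hx⟩
    obtain ⟨m, hm⟩ := hU x hx
    let F : Finset (ULift.{w} ℕ) := (Finset.range m).map Equiv.ulift.symm.toEmbedding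
    refine ⟨DFinsupp.mk F fun n => φ x n, funext fun n => ?_⟩
    change DFinsupp.mk F (fun n => φ x n) n = φ x n
    rw [DFinsupp.mk_apply]
    split_ifs with hn
    · rfl
    · have : m ≤ n.down := by
        by_contra hlt
        exact hn (Finset.mem_map.2 ⟨n.down, Finset.mem_range.2 (not_le.1 hlt), rfl⟩)
      exact ((hφ n.down x).1 (L.monotone this hm)).symm
  let f : U →ₗ[S] DirectSum (ULift.{w} ℕ) E :=
    (LinearEquiv.ofInjective c hc).symm.toLinearMap.comp
      ((φ.comp U.subtype).codRestrict _ hrange)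
  have hf : ∀ x : U, c (f x) = φ x := fun x =>
    congrArg Subtype.val ((LinearEquiv.ofInjective c hc).apply_symm_apply ⟨φ x, hrange x⟩)
  obtain ⟨k, hk⟩ := hsum U (I.P g) U.subtype U.injective_subtype f
  let y := k ⟨I.p g, I.p_mem_P g⟩
  obtain ⟨m, hm⟩ : ∃ m : ℕ, c y ⟨m⟩ = 0 := by
    obtain ⟨n, hn⟩ := Infinite.exists_notMem_finset (DFinsupp.support y)
    exact ⟨n.down, DFinsupp.notMem_support_iff.1 hn⟩
  refine ⟨m, fun n hmn => le_antisymm (L.monotone hmn) fun x hx => ?_⟩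
  have hxU : x ∈ U := le_iSup (fun n => L n) n hx
  rw [hφ, ← hf ⟨x, hxU⟩, ← hk, I.eq_ofP g k]
  change c ((x : S) • y) ⟨m⟩ = 0
  rw [map_smul, Pi.smul_apply, hm, smul_zero]

/-! ### The Faith–Walker theorem for rational modules -/

theorem isNoetherian_and_isInj_iff : (IsNoetherian S (I.P 0) ∧ I.IsInj (I.P 0)) ↔
    ∀ (N : Type w) [AddCommGroup N] [Module S N] [I.Rational N], I.IsInj N ↔ I.IsProj N := by
  constructor
  · rintro ⟨hN, hI⟩ N _ _ _
    have := I.isNoetherian_P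
    have hinj : ∀ g, I.IsInj (I.P g) := fun g => (hI.tw (-g)).of_equiv (I.PEquivTw g)
    exact ⟨fun h => h.isProj hinj, fun h => h.isInj hinj⟩
  · exact fun h => ⟨isNoetherian_of_isInj_iff_isProj h 0, (h _).2 (I.isProj_P 0)⟩

end IdempotentSystem

/-! ### The smash product of a graded ring with its grading group -/

section Smash

variable {G : Type u} [AddGroup G] {R : Type v} [Ring R] (𝒜 : G → AddSubgroup R)

/-- The defining relations of the smash product: the elements of `R` satisfy the relations of `R`,
the idempotents are orthogonal, and a homogeneous element of degree `h` passes from the idempotent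
of index `g` to the one of index `h + g`. -/
inductive SmashRel : FreeAlgebra ℤ (R ⊕ G) → FreeAlgebra ℤ (R ⊕ G) → Prop
  | one : SmashRel (FreeAlgebra.ι ℤ (Sum.inl 1)) 1
  | add (r s : R) : SmashRel (FreeAlgebra.ι ℤ (Sum.inl (r + s)))
      (FreeAlgebra.ι ℤ (Sum.inl r) + FreeAlgebra.ι ℤ (Sum.inl s))
  | mul (r s : R) : SmashRel (FreeAlgebra.ι ℤ (Sum.inl (r * s)))
      (FreeAlgebra.ι ℤ (Sum.inl r) * FreeAlgebra.ι ℤ (Sum.inl s))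
  | idem (g : G) : SmashRel (FreeAlgebra.ι ℤ (Sum.inr g) * FreeAlgebra.ι ℤ (Sum.inr g))
      (FreeAlgebra.ι ℤ (Sum.inr g))
  | orth (g h : G) : g ≠ h →
      SmashRel (FreeAlgebra.ι ℤ (Sum.inr g) * FreeAlgebra.ι ℤ (Sum.inr h)) 0
  | comm (g h : G) (r : R) : r ∈ 𝒜 h →
      SmashRel (FreeAlgebra.ι ℤ (Sum.inr (h + g)) * FreeAlgebra.ι ℤ (Sum.inl r))
        (FreeAlgebra.ι ℤ (Sum.inl r) * FreeAlgebra.ι ℤ (Sum.inr g))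

/-- The ring generated by `R` and orthogonal idempotents that project graded `R`-modules to their
homogeneous components. Graded `R`-modules are rational modules over it. -/
def Smash : Type (max u v) := RingQuot (SmashRel 𝒜)

namespace Smash

noncomputable instance : Ring (Smash 𝒜) := inferInstanceAs (Ring (RingQuot (SmashRel 𝒜)))

/-- The quotient map from the free algebra. -/
noncomputable def mk : FreeAlgebra ℤ (R ⊕ G) →+* Smash 𝒜 := RingQuot.mkRingHom (SmashRel 𝒜)

lemma mk_rel {x y : FreeAlgebra ℤ (R ⊕ G)} (h : SmashRel 𝒜 x y) : mk 𝒜 x = mk 𝒜 y :=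
  RingQuot.mkRingHom_rel h

/-- The map from `R` to the smash product. -/
noncomputable def ι : R →+* Smash 𝒜 :=
  RingHom.mk' ⟨⟨fun r => mk 𝒜 (FreeAlgebra.ι ℤ (Sum.inl r)), by
      rw [mk_rel 𝒜 .one, map_one]⟩, fun r s => by
      change mk 𝒜 _ = mk 𝒜 _ * mk 𝒜 _
      rw [mk_rel 𝒜 (.mul r s), map_mul]⟩
    fun r s => by
      change mk 𝒜 _ = mk 𝒜 _ + mk 𝒜 _
      rw [mk_rel 𝒜 (.add r s), map_add]

/-- The idempotents of the smash product. -/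
noncomputable def p (g : G) : Smash 𝒜 := mk 𝒜 (FreeAlgebra.ι ℤ (Sum.inr g))

lemma p_mul_self (g : G) : p 𝒜 g * p 𝒜 g = p 𝒜 g := by
  rw [p, ← map_mul, mk_rel 𝒜 (.idem g)]

lemma p_mul_of_ne {g h : G} (hgh : g ≠ h) : p 𝒜 g * p 𝒜 h = 0 := by
  rw [p, p, ← map_mul, mk_rel 𝒜 (.orth g h hgh), map_zero]

lemma p_mul_ι {g h : G} {r : R} (hr : r ∈ 𝒜 h) : p 𝒜 (h + g) * ι 𝒜 r = ι 𝒜 r * p 𝒜 g := by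
  change mk 𝒜 _ * mk 𝒜 _ = mk 𝒜 _ * mk 𝒜 _
  rw [← map_mul, mk_rel 𝒜 (.comm g h r hr), map_mul]

variable {𝒜}

@[elab_as_elim]
lemma induction {motive : Smash 𝒜 → Prop} (s : Smash 𝒜) (int : ∀ n : ℤ, motive n)
    (ι : ∀ r, motive (ι 𝒜 r)) (p : ∀ g, motive (p 𝒜 g))
    (add : ∀ a b, motive a → motive b → motive (a + b))
    (mul : ∀ a b, motive a → motive b → motive (a * b)) : motive s := by
  obtain ⟨x, rfl⟩ : ∃ x, mk 𝒜 x = s := RingQuot.mkRingHom_surjective _ s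
  induction x using FreeAlgebra.induction with
  | grade0 n => simpa using int n
  | grade1 x =>
    rcases x with r | g
    · exact ι r
    · exact p g
  | mul a b ha hb => simpa using mul _ _ ha hb
  | add a b ha hb => simpa using add _ _ ha hb

lemma ringHom_ext {T : Type*} [Ring T] {f f' : Smash 𝒜 →+* T} (hι : ∀ r, f (ι 𝒜 r) = f' (ι 𝒜 r))
    (hp : ∀ g, f (p 𝒜 g) = f' (p 𝒜 g)) : f = f' := by
  ext s
  induction s using Smash.induction with
  | int n => simp
  | ι r => exact hι r
  | p g => exact hp g
  | add a b ha hb => rw [map_add, map_add, ha, hb]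
  | mul a b ha hb => rw [map_mul, map_mul, ha, hb]

/-- The universal property of the smash product. -/
noncomputable def lift {T : Type*} [Ring T] (f : R →+* T) (q : G → T)
    (idem : ∀ g, q g * q g = q g) (orth : ∀ g h, g ≠ h → q g * q h = 0)
    (comm : ∀ g h, ∀ r ∈ 𝒜 h, q (h + g) * f r = f r * q g) : Smash 𝒜 →+* T :=
  RingQuot.lift ⟨(FreeAlgebra.lift ℤ (Sum.elim f q) : FreeAlgebra ℤ (R ⊕ G) →+* T), by
    rintro _ _ (_ | _ | _ | g | ⟨g, h, hgh⟩ | ⟨g, h, r, hr⟩)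
    · simp
    · simp
    · simp
    · simp [idem]
    · simp [orth g h hgh]
    · simp [comm g h r hr]⟩

section

variable {T : Type*} [Ring T] (f : R →+* T) (q : G → T)
  (idem : ∀ g, q g * q g = q g) (orth : ∀ g h, g ≠ h → q g * q h = 0)
  (comm : ∀ g h, ∀ r ∈ 𝒜 h, q (h + g) * f r = f r * q g)

@[simp]
lemma lift_ι (r : R) : lift f q idem orth comm (ι 𝒜 r) = f r := by
  refine (RingQuot.lift_mkRingHom_apply _ _ _).trans ?_
  simp

@[simp]
lemma lift_p (g : G) : lift f q idem orth comm (p 𝒜 g) = q g := by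
  refine (RingQuot.lift_mkRingHom_apply _ _ _).trans ?_
  simp

end

variable (𝒜) in
/-- Translation of the idempotents. -/
noncomputable def shiftHom (k : G) : Smash 𝒜 →+* Smash 𝒜 :=
  lift (ι 𝒜) (fun g => p 𝒜 (g + k)) (fun g => p_mul_self 𝒜 _)
    (fun g h hgh => p_mul_of_ne 𝒜 fun h' => hgh (add_right_cancel h'))
    fun g h r hr => by rw [add_assoc, p_mul_ι 𝒜 hr]

@[simp]
lemma shiftHom_ι (k : G) (r : R) : shiftHom 𝒜 k (ι 𝒜 r) = ι 𝒜 r := lift_ι ..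

@[simp]
lemma shiftHom_p (k g : G) : shiftHom 𝒜 k (p 𝒜 g) = p 𝒜 (g + k) := lift_p ..

lemma shiftHom_add (k l : G) : shiftHom 𝒜 (k + l) = (shiftHom 𝒜 l).comp (shiftHom 𝒜 k) :=
  ringHom_ext (by simp) (by simp [add_assoc])

lemma shiftHom_zero : shiftHom 𝒜 0 = RingHom.id (Smash 𝒜) := ringHom_ext (by simp) (by simp)

/-- A finite sum of left multiples of idempotents stays so under left multiplication. -/
lemma mul_mem_closure [DecidableEq G] [GradedRing 𝒜] (s : Smash 𝒜) {y : Smash 𝒜}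
    (hy : y ∈ AddSubgroup.closure {t | ∃ h, p 𝒜 h * t = t}) :
    s * y ∈ AddSubgroup.closure {t | ∃ h, p 𝒜 h * t = t} := by
  classical
  induction s using Smash.induction generalizing y with
  | int n =>
    rw [← zsmul_eq_mul]
    exact zsmul_mem hy n
  | ι r =>
    induction hy using AddSubgroup.closure_induction with
    | zero => simp
    | add a b _ _ ha hb => rw [mul_add]; exact add_mem ha hb
    | neg a _ ha => rw [mul_neg]; exact neg_mem ha
    | mem y hy =>
      obtain ⟨h, hy⟩ := hy
      rw [← DirectSum.sum_support_decompose 𝒜 r, map_sum, Finset.sum_mul]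
      refine sum_mem fun k _ => AddSubgroup.subset_closure ⟨k + h, ?_⟩
      rw [← mul_assoc, p_mul_ι 𝒜 (SetLike.coe_mem _), mul_assoc, hy]
  | p g =>
    induction hy using AddSubgroup.closure_induction with
    | zero => simp
    | add a b _ _ ha hb => rw [mul_add]; exact add_mem ha hb
    | neg a _ ha => rw [mul_neg]; exact neg_mem ha
    | mem y hy => exact AddSubgroup.subset_closure ⟨g, by rw [← mul_assoc, p_mul_self]⟩
  | add a b ha hb => rw [add_mul]; exact add_mem (ha hy) (hb hy)
  | mul a b ha hb => rw [mul_assoc]; exact ha (hb hy)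

lemma exists_sum_of_mem_closure {y : Smash 𝒜}
    (hy : y ∈ AddSubgroup.closure {t | ∃ h, p 𝒜 h * t = t}) :
    ∃ F : Finset G, ∀ F', F ⊆ F' → ∑ h ∈ F', p 𝒜 h * y = y := by
  classical
  induction hy using AddSubgroup.closure_induction with
  | zero => exact ⟨∅, by simp⟩
  | add a b _ _ ha hb =>
    obtain ⟨F, hF⟩ := ha
    obtain ⟨F', hF'⟩ := hb
    refine ⟨F ∪ F', fun F'' h => ?_⟩
    simp only [mul_add, Finset.sum_add_distrib]
    rw [hF _ (Finset.union_subset_left h), hF' _ (Finset.union_subset_right h)]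
  | neg a _ ha =>
    obtain ⟨F, hF⟩ := ha
    exact ⟨F, fun F' h => by simp [hF F' h]⟩
  | mem y hy =>
    obtain ⟨h, hy⟩ := hy
    refine ⟨{h}, fun F' hF' => ?_⟩
    rw [Finset.sum_eq_single_of_mem h (by simpa using hF'), hy]
    intro k _ hk
    rw [← hy, ← mul_assoc, p_mul_of_ne 𝒜 hk, zero_mul]

variable (𝒜) in
/-- The idempotents of the smash product and their translations. -/
noncomputable def system [DecidableEq G] [GradedRing 𝒜] : IdempotentSystem G (Smash 𝒜) where
  p := p 𝒜
  mul_self := p_mul_self 𝒜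
  mul_of_ne _ _ := p_mul_of_ne 𝒜
  exists_sum s g := by
    obtain ⟨F, hF⟩ := exists_sum_of_mem_closure
      (mul_mem_closure s (AddSubgroup.subset_closure ⟨g, p_mul_self 𝒜 g⟩))
    exact ⟨F, hF F subset_rfl⟩
  shift k := RingEquiv.ofRingHom (shiftHom 𝒜 k) (shiftHom 𝒜 (-k))
    (by rw [← shiftHom_add, neg_add_cancel, shiftHom_zero])
    (by rw [← shiftHom_add, add_neg_cancel, shiftHom_zero])
  shift_p k g := shiftHom_p k g
  shift_zero s := by simp [shiftHom_zero]
  shift_add k l s := by simp [shiftHom_add]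

@[simp]
lemma system_p [DecidableEq G] [GradedRing 𝒜] (g : G) : (system 𝒜).p g = p 𝒜 g := rfl

/-- An additive map that commutes with `R` and with the idempotents is linear over the smash
product. -/
def linearMapOfCommutes {N N' : Type*} [AddCommGroup N] [Module (Smash 𝒜) N] [AddCommGroup N']
    [Module (Smash 𝒜) N'] (f : N →+ N') (hι : ∀ r x, f (ι 𝒜 r • x) = ι 𝒜 r • f x)
    (hp : ∀ g x, f (p 𝒜 g • x) = p 𝒜 g • f x) : N →ₗ[Smash 𝒜] N' where
  toAddHom := f.toAddHom
  map_smul' s x := by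
    change f (s • x) = s • f x
    induction s using Smash.induction generalizing x with
    | int n => rw [Int.cast_smul_eq_zsmul, Int.cast_smul_eq_zsmul, map_zsmul]
    | ι r => exact hι r x
    | p g => exact hp g x
    | add a b ha hb => rw [add_smul, add_smul, map_add, ha, hb]
    | mul a b ha hb => rw [mul_smul, mul_smul, ha, hb]

end Smash

end Smash

/-! ### Graded modules as rational modules over the smash product -/

namespace GrModCat

open CategoryTheory

variable {G : Type u} [AddGroup G] [DecidableEq G] {R : Type v} [Ring R] {𝒜 : G → AddSubgroup R}

section ToSmash

variable (M : GrModCat.{u, v, w} 𝒜)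

/-- The projection of a graded module to a homogeneous component. -/
def proj (g : G) : Module.End ℤ M.carrier :=
  AddMonoidHom.toIntLinearMap
    { toFun := fun x => DirectSum.decompose M.grading x g
      map_zero' := by simp
      map_add' := fun x y => by simp }

lemma proj_mem (g : G) (x : M.carrier) : M.proj g x ∈ M.grading g := SetLike.coe_mem _

lemma proj_of_mem {g : G} {x : M.carrier} (hx : x ∈ M.grading g) : M.proj g x = x :=
  DirectSum.decompose_of_mem_same _ hx

lemma proj_of_mem_of_ne {g h : G} {x : M.carrier} (hx : x ∈ M.grading g) (hgh : g ≠ h) :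
    M.proj h x = 0 := DirectSum.decompose_of_mem_ne _ hx hgh

lemma proj_smul {h : G} {r : R} (hr : r ∈ 𝒜 h) (g : G) (x : M.carrier) :
    M.proj (h + g) (r • x) = r • M.proj g x := by
  induction x using DirectSum.Decomposition.inductionOn M.grading with
  | zero => simp
  | @homogeneous k m =>
    have hm : r • (m : M.carrier) ∈ M.grading (h + k) :=
      SetLike.GradedSMul.smul_mem (A := 𝒜) (B := M.grading) hr m.2
    by_cases hk : k = g
    · subst hk
      rw [M.proj_of_mem m.2, M.proj_of_mem hm]
    · rw [M.proj_of_mem_of_ne m.2 hk, M.proj_of_mem_of_ne hm (by simpa using hk), smul_zero]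
  | add m m' hm hm' => rw [smul_add, map_add, map_add, hm, hm', smul_add]

/-- The action of the smash product on a graded module. -/
noncomputable def smashToEnd : Smash 𝒜 →+* Module.End ℤ M.carrier :=
  Smash.lift (Module.toModuleEnd ℤ M.carrier) M.proj
    (fun g => LinearMap.ext fun x => M.proj_of_mem (M.proj_mem g x))
    (fun _ h hgh => LinearMap.ext fun x => M.proj_of_mem_of_ne (M.proj_mem h x) (Ne.symm hgh))
    fun g _ _ hr => LinearMap.ext fun x => M.proj_smul hr g x

noncomputable instance : Module (Smash 𝒜) M.carrier := Module.compHom _ M.smashToEnd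

variable {M}

lemma ι_smul (r : R) (x : M.carrier) : Smash.ι 𝒜 r • x = r • x := by
  change M.smashToEnd (Smash.ι 𝒜 r) x = _
  rw [smashToEnd, Smash.lift_ι]
  rfl

lemma p_smul (g : G) (x : M.carrier) : Smash.p 𝒜 g • x = M.proj g x := by
  change M.smashToEnd (Smash.p 𝒜 g) x = _
  rw [smashToEnd, Smash.lift_p]

lemma p_smul_eq_iff {g : G} {x : M.carrier} : Smash.p 𝒜 g • x = x ↔ x ∈ M.grading g := by
  rw [p_smul]
  exact ⟨fun h => h ▸ M.proj_mem g x, M.proj_of_mem⟩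

instance [GradedRing 𝒜] : (Smash.system 𝒜).Rational M.carrier :=
  ⟨fun x => by
    classical
    refine ⟨(DirectSum.decompose M.grading x).support, ?_⟩
    conv_rhs => rw [← DirectSum.sum_support_decompose M.grading x]
    exact Finset.sum_congr rfl fun g _ => p_smul g x⟩

end ToSmash

section OfSmash

variable (N : Type w) [AddCommGroup N] [Module (Smash 𝒜) N]

variable (𝒜) in
/-- The homogeneous components of a module over the smash product. -/
def component (g : G) : AddSubgroup N where
  carrier := {x | Smash.p 𝒜 g • x = x}
  zero_mem' := smul_zero _
  add_mem' {a b} ha hb := by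
    change _ • (a + b) = a + b
    rw [smul_add, ha, hb]
  neg_mem' {a} ha := by
    change _ • (-a) = -a
    rw [smul_neg, ha]

omit [DecidableEq G] in
variable {N} in
lemma mem_component {g : G} {x : N} : x ∈ component 𝒜 N g ↔ Smash.p 𝒜 g • x = x := Iff.rfl

lemma p_smul_coeAddMonoidHom (x : DirectSum G fun g => component 𝒜 N g) (g : G) :
    Smash.p 𝒜 g • DirectSum.coeAddMonoidHom (component 𝒜 N) x = x g := by
  induction x using DirectSum.induction_on with
  | zero => simp
  | of h x =>
    rw [DirectSum.coeAddMonoidHom_of, DirectSum.coe_of_apply]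
    split_ifs with hgh
    · subst hgh
      exact x.2
    · rw [← mem_component.1 x.2, smul_smul, Smash.p_mul_of_ne 𝒜 (Ne.symm hgh), zero_smul]
      rfl
  | add x y hx hy => rw [map_add, smul_add, hx, hy]; rfl

variable [GradedRing 𝒜]

lemma isInternal_component [(Smash.system 𝒜).Rational N] :
    DirectSum.IsInternal (component 𝒜 N) := by
  constructor
  · refine (injective_iff_map_eq_zero _).2 fun x hx => ?_
    ext g
    rw [← p_smul_coeAddMonoidHom, hx, smul_zero]
    rfl
  · intro x
    obtain ⟨F, hF⟩ := IdempotentSystem.Rational.exists_sum (I := Smash.system 𝒜) x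
    refine ⟨∑ g ∈ F, DirectSum.of (fun g => component 𝒜 N g) g
      ⟨Smash.p 𝒜 g • x, (Smash.system 𝒜).p_smul_p_smul_self g x⟩, ?_⟩
    rw [map_sum]
    simpa [DirectSum.coeAddMonoidHom_of] using hF

variable (𝒜) in
/-- A rational module over the smash product, as a graded module. -/
noncomputable def ofSmash [(Smash.system 𝒜).Rational N] : GrModCat.{u, v, w} 𝒜 :=
  letI : Module R N := Module.compHom N (Smash.ι 𝒜)
  { carrier := N
    grading := component 𝒜 N
    decomposition := (isInternal_component N).chooseDecomposition
    gradedSMul := ⟨fun {h g r x} hr hx => by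
      change Smash.p 𝒜 (h + g) • Smash.ι 𝒜 r • x = Smash.ι 𝒜 r • x
      rw [smul_smul, Smash.p_mul_ι 𝒜 hr, mul_smul, mem_component.1 hx]⟩ }

variable [(Smash.system 𝒜).Rational N]

variable (𝒜) in
/-- The identity map from a rational module to the associated graded module. -/
noncomputable def toOfSmash : N ≃+ (ofSmash 𝒜 N).carrier := AddEquiv.refl N

variable {N} in
lemma smul_toOfSmash (r : R) (x : N) :
    r • toOfSmash 𝒜 N x = toOfSmash 𝒜 N (Smash.ι 𝒜 r • x) := rfl

variable {N} in
lemma toOfSmash_mem {g : G} {x : N} :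
    toOfSmash 𝒜 N x ∈ (ofSmash 𝒜 N).grading g ↔ Smash.p 𝒜 g • x = x := Iff.rfl

variable {N} in
lemma p_smul_toOfSmash (g : G) (x : N) :
    Smash.p 𝒜 g • toOfSmash 𝒜 N x = toOfSmash 𝒜 N (Smash.p 𝒜 g • x) := by
  obtain ⟨F, hF⟩ := IdempotentSystem.Rational.exists_sum (I := Smash.system 𝒜) x
  rw [← hF, map_sum, Finset.smul_sum, Finset.smul_sum, map_sum]
  refine Finset.sum_congr rfl fun h _ => ?_
  have hmem : toOfSmash 𝒜 N (Smash.p 𝒜 h • x) ∈ (ofSmash 𝒜 N).grading h :=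
    toOfSmash_mem.2 ((Smash.system 𝒜).p_smul_p_smul_self h x)
  rw [Smash.system_p]
  by_cases hgh : h = g
  · subst hgh
    rw [p_smul_eq_iff.2 hmem, toOfSmash_mem.1 hmem]
  · rw [p_smul, proj_of_mem_of_ne _ hmem hgh, smul_smul, Smash.p_mul_of_ne 𝒜 (Ne.symm hgh),
      zero_smul, map_zero]

variable (𝒜) in
/-- A rational module is isomorphic to the module given by the associated graded module. -/
noncomputable def ofSmashEquiv : (ofSmash 𝒜 N).carrier ≃ₗ[Smash 𝒜] N :=
  (LinearEquiv.ofBijective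
    (Smash.linearMapOfCommutes (toOfSmash 𝒜 N).toAddMonoidHom
      (fun r x => by
        rw [ι_smul]
        exact (smul_toOfSmash r x).symm) fun g x => (p_smul_toOfSmash g x).symm)
    (toOfSmash 𝒜 N).bijective).symm

end OfSmash

/-- A morphism of graded modules is linear over the smash product. -/
noncomputable def Hom.toSmash {M N : GrModCat.{u, v, w} 𝒜} (f : M ⟶ N) :
    M.carrier →ₗ[Smash 𝒜] N.carrier :=
  Smash.linearMapOfCommutes (Hom.toLinearMap f).toAddMonoidHom
    (fun r x => by
      rw [ι_smul, ι_smul]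
      exact map_smul (Hom.toLinearMap f) r x)
    fun g x => by
      rw [p_smul, p_smul]
      change Hom.toLinearMap f (M.proj g x) = N.proj g (Hom.toLinearMap f x)
      induction x using DirectSum.Decomposition.inductionOn M.grading with
      | zero => simp
      | @homogeneous k m =>
        have hm := Hom.map_mem f k m m.2
        by_cases hk : k = g
        · subst hk
          rw [M.proj_of_mem m.2, N.proj_of_mem hm]
        · rw [M.proj_of_mem_of_ne m.2 hk, N.proj_of_mem_of_ne hm hk, map_zero]
      | add m m' hm hm' => simp only [map_add, hm, hm']

/-- A map that is linear over the smash product is a morphism of graded modules. -/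
noncomputable def homOfSmash {M N : GrModCat.{u, v, w} 𝒜} (f : M.carrier →ₗ[Smash 𝒜] N.carrier) :
    M ⟶ N where
  toLinearMap :=
    { toAddHom := f.toAddHom
      map_smul' := fun r x => by
        change f (r • x) = r • f x
        rw [← ι_smul, map_smul, ι_smul] }
  map_mem g x hx := by
    change f x ∈ _
    rw [← p_smul_eq_iff] at *
    rw [← map_smul, hx]

lemma hom_ext {M N : GrModCat.{u, v, w} 𝒜} {f f' : M ⟶ N}
    (h : ∀ x, Hom.toSmash f x = Hom.toSmash f' x) : f = f' :=
  Hom.ext (LinearMap.ext h)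

@[simp]
lemma toSmash_homOfSmash {M N : GrModCat.{u, v, w} 𝒜} (f : M.carrier →ₗ[Smash 𝒜] N.carrier)
    (x : M.carrier) : Hom.toSmash (homOfSmash f) x = f x := rfl

@[simp]
lemma toSmash_comp {M N L : GrModCat.{u, v, w} 𝒜} (f : M ⟶ N) (g : N ⟶ L)
    (x : M.carrier) : Hom.toSmash (f ≫ g) x = Hom.toSmash g (Hom.toSmash f x) := rfl

section

variable [GradedRing 𝒜] {M N : GrModCat.{u, v, w} 𝒜}

lemma mono_iff_injective (f : M ⟶ N) : Mono f ↔ Function.Injective (Hom.toSmash f) := by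
  constructor
  · intro hf
    rw [← LinearMap.ker_eq_bot]
    let K := LinearMap.ker (Hom.toSmash f)
    let a : ofSmash 𝒜 K ⟶ M := homOfSmash (K.subtype.comp (ofSmashEquiv 𝒜 K).toLinearMap)
    let b : ofSmash 𝒜 K ⟶ M := homOfSmash 0
    have hab : a = b := by
      rw [← cancel_mono f]
      refine hom_ext fun x => ?_
      rw [toSmash_comp, toSmash_comp]
      simp only [a, b, toSmash_homOfSmash, LinearMap.zero_apply, map_zero]
      exact LinearMap.mem_ker.1 (ofSmashEquiv 𝒜 K x).2
    refine (Submodule.eq_bot_iff _).2 fun x hx => ?_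
    have := congrArg (fun c => Hom.toSmash c ((ofSmashEquiv 𝒜 K).symm ⟨x, hx⟩)) hab
    simpa [a, b] using this
  · intro hf
    refine ⟨fun a b hab => hom_ext fun x => hf ?_⟩
    rw [← toSmash_comp, hab, toSmash_comp]

lemma epi_iff_surjective (f : M ⟶ N) : Epi f ↔ Function.Surjective (Hom.toSmash f) := by
  constructor
  · intro hf
    rw [← LinearMap.range_eq_top]
    let K := LinearMap.range (Hom.toSmash f)
    let a : N ⟶ ofSmash 𝒜 (N.carrier ⧸ K) :=
      homOfSmash ((ofSmashEquiv 𝒜 (N.carrier ⧸ K)).symm.toLinearMap.comp K.mkQ)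
    let b : N ⟶ ofSmash 𝒜 (N.carrier ⧸ K) := homOfSmash 0
    have hab : a = b := by
      rw [← cancel_epi f]
      refine hom_ext fun x => ?_
      rw [toSmash_comp, toSmash_comp]
      have : K.mkQ (Hom.toSmash f x) = 0 := (Submodule.Quotient.mk_eq_zero _).2 ⟨x, rfl⟩
      simp [a, b, this]
    refine (Submodule.eq_top_iff').2 fun x => ?_
    have := congrArg (fun c => Hom.toSmash c x) hab
    have hx : K.mkQ x = 0 := by simpa [a, b] using this
    exact (Submodule.Quotient.mk_eq_zero _).1 hx
  · intro hf
    refine ⟨fun a b hab => hom_ext fun x => ?_⟩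
    obtain ⟨y, rfl⟩ := hf x
    rw [← toSmash_comp, hab, toSmash_comp]

end

section

variable {G : Type u} [AddGroup G] [DecidableEq G] {R : Type (max u v)} [Ring R]
  {𝒜 : G → AddSubgroup R} [GradedRing 𝒜] (M : GrModCat.{u, max u v, max u v} 𝒜)

lemma injective_iff_isInj : Injective M ↔ (Smash.system 𝒜).IsInj M.carrier := by
  constructor
  · intro hM X Y _ _ _ _ _ _ f hf g
    let f' : ofSmash 𝒜 X ⟶ ofSmash 𝒜 Y := homOfSmash
      ((ofSmashEquiv 𝒜 Y).symm.toLinearMap.comp (f.comp (ofSmashEquiv 𝒜 X).toLinearMap))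
    let g' : ofSmash 𝒜 X ⟶ M := homOfSmash (g.comp (ofSmashEquiv 𝒜 X).toLinearMap)
    have : Mono f' := (mono_iff_injective f').2 fun x y h => by
      simpa [f', hf.eq_iff] using h
    refine ⟨(Hom.toSmash (Injective.factorThru g' f')).comp (ofSmashEquiv 𝒜 Y).symm.toLinearMap,
      fun x => ?_⟩
    have h : Hom.toSmash (Injective.factorThru g' f')
        (Hom.toSmash f' ((ofSmashEquiv 𝒜 X).symm x)) =
        Hom.toSmash g' ((ofSmashEquiv 𝒜 X).symm x) := by
      rw [← toSmash_comp, Injective.comp_factorThru]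
    have hf' : Hom.toSmash f' ((ofSmashEquiv 𝒜 X).symm x) = (ofSmashEquiv 𝒜 Y).symm (f x) := by
      simp [f']
    have hg' : Hom.toSmash g' ((ofSmashEquiv 𝒜 X).symm x) = g x := by simp [g']
    rwa [hf', hg'] at h
  · intro hM
    refine ⟨fun {X Y} g f hf => ?_⟩
    obtain ⟨h, hh⟩ := hM X.carrier Y.carrier (Hom.toSmash f) ((mono_iff_injective f).1 hf)
      (Hom.toSmash g)
    exact ⟨homOfSmash h, hom_ext fun x => hh x⟩

lemma projective_iff_isProj : Projective M ↔ (Smash.system 𝒜).IsProj M.carrier := by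
  constructor
  · intro hM X Y _ _ _ _ _ _ f hf g
    let f' : ofSmash 𝒜 X ⟶ ofSmash 𝒜 Y := homOfSmash
      ((ofSmashEquiv 𝒜 Y).symm.toLinearMap.comp (f.comp (ofSmashEquiv 𝒜 X).toLinearMap))
    let g' : M ⟶ ofSmash 𝒜 Y := homOfSmash ((ofSmashEquiv 𝒜 Y).symm.toLinearMap.comp g)
    have : Epi f' := (epi_iff_surjective f').2
      ((ofSmashEquiv 𝒜 Y).symm.surjective.comp (hf.comp (ofSmashEquiv 𝒜 X).surjective))
    refine ⟨(ofSmashEquiv 𝒜 X).toLinearMap.comp (Hom.toSmash (Projective.factorThru g' f')),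
      fun x => ?_⟩
    have h : Hom.toSmash f' (Hom.toSmash (Projective.factorThru g' f') x) =
        Hom.toSmash g' x := by
      rw [← toSmash_comp, Projective.factorThru_comp]
    exact (ofSmashEquiv 𝒜 Y).symm.injective h
  · intro hM
    refine ⟨fun {X Y} g f hf => ?_⟩
    obtain ⟨h, hh⟩ := hM X.carrier Y.carrier (Hom.toSmash f) ((epi_iff_surjective f).1 hf)
      (Hom.toSmash g)
    exact ⟨homOfSmash h, hom_ext fun x => hh x⟩

end

/-! ### The graded ring as a rational module -/

section Self

variable (𝒜) [GradedRing 𝒜]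

/-- The identity map from the ring to the corresponding graded module. -/
def ofRing : R ≃+ (GrModCat.self 𝒜).carrier := AddEquiv.refl R

variable {𝒜} in
lemma smul_ofRing (r x : R) : r • ofRing 𝒜 x = ofRing 𝒜 (r * x) := rfl

variable {𝒜} in
lemma ι_smul_ofRing (r x : R) : Smash.ι 𝒜 r • ofRing 𝒜 x = ofRing 𝒜 (r * x) := by
  rw [ι_smul, smul_ofRing]

variable {𝒜} in
lemma p_smul_ofRing (g : G) (x : R) :
    Smash.p 𝒜 g • ofRing 𝒜 x = ofRing 𝒜 (DirectSum.decompose 𝒜 x g) := by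
  rw [p_smul]
  rfl

lemma p_zero_smul_ofRing_one : Smash.p 𝒜 0 • ofRing 𝒜 1 = ofRing 𝒜 1 := by
  rw [p_smul_ofRing, DirectSum.decompose_of_mem_same 𝒜 (SetLike.one_mem_graded 𝒜)]

variable {𝒜} in
lemma ι_decompose_mul_p_zero (g : G) (x : R) :
    Smash.ι 𝒜 (DirectSum.decompose 𝒜 x g : R) * Smash.p 𝒜 0 =
      Smash.p 𝒜 g * (Smash.ι 𝒜 x * Smash.p 𝒜 0) := by
  induction x using DirectSum.Decomposition.inductionOn 𝒜 with
  | zero => simp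
  | @homogeneous k m =>
    have hm : Smash.ι 𝒜 (m : R) * Smash.p 𝒜 0 = Smash.p 𝒜 k * Smash.ι 𝒜 (m : R) := by
      rw [← Smash.p_mul_ι 𝒜 m.2, add_zero]
    by_cases hk : k = g
    · subst hk
      rw [DirectSum.decompose_of_mem_same 𝒜 m.2, hm, ← mul_assoc, Smash.p_mul_self]
    · rw [DirectSum.decompose_of_mem_ne 𝒜 m.2 hk, hm, ← mul_assoc,
        Smash.p_mul_of_ne 𝒜 (Ne.symm hk), zero_mul, map_zero, zero_mul]
  | add m m' hm hm' =>
    rw [DirectSum.decompose_add, DirectSum.add_apply, AddSubgroup.coe_add, map_add, map_add,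
      add_mul, add_mul, mul_add, hm, hm']

/-- The map `r ↦ r p_0`. -/
noncomputable def selfToP : (GrModCat.self 𝒜).carrier →ₗ[Smash 𝒜] (Smash.system 𝒜).P 0 :=
  Smash.linearMapOfCommutes
    ((AddMonoidHom.mk' (fun r : R => (⟨Smash.ι 𝒜 r * Smash.p 𝒜 0,
        (Smash.system 𝒜).mul_p_mem_P _ 0⟩ : (Smash.system 𝒜).P 0))
      fun a b => Subtype.ext (by simp [add_mul])).comp (ofRing 𝒜).symm.toAddMonoidHom)
    (fun r x => by
      obtain ⟨x, rfl⟩ := (ofRing 𝒜).surjective x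
      rw [ι_smul_ofRing]
      exact Subtype.ext (by simp [mul_assoc]))
    (fun g x => by
      obtain ⟨x, rfl⟩ := (ofRing 𝒜).surjective x
      rw [p_smul_ofRing]
      exact Subtype.ext (by simpa using ι_decompose_mul_p_zero g x))

lemma coe_selfToP_ofRing (x : R) :
    (selfToP 𝒜 (ofRing 𝒜 x) : Smash 𝒜) = Smash.ι 𝒜 x * Smash.p 𝒜 0 := rfl

/-- The graded ring is the left ideal generated by the idempotent of index zero. -/
noncomputable def selfEquiv : (Smash.system 𝒜).P 0 ≃ₗ[Smash 𝒜] (GrModCat.self 𝒜).carrier :=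
  LinearEquiv.ofLinearMap ((Smash.system 𝒜).ofP 0 (ofRing 𝒜 1)) (selfToP 𝒜)
    (LinearMap.ext fun x => by
      obtain ⟨x, rfl⟩ := (ofRing 𝒜).surjective x
      rw [LinearMap.comp_apply, IdempotentSystem.ofP_apply, coe_selfToP_ofRing, mul_smul,
        p_zero_smul_ofRing_one, ι_smul_ofRing, mul_one, LinearMap.id_apply])
    (by
      rw [(Smash.system 𝒜).eq_ofP 0 ((selfToP 𝒜).comp _),
        (Smash.system 𝒜).eq_ofP 0 LinearMap.id]
      congr 1
      refine Subtype.ext ?_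
      change (selfToP 𝒜 (Smash.p 𝒜 0 • ofRing 𝒜 1) : Smash 𝒜) = Smash.p 𝒜 0
      rw [p_zero_smul_ofRing_one, coe_selfToP_ofRing, map_one, one_mul])

/-- The homogeneous left ideals are the submodules over the smash product. -/
noncomputable def submoduleOrderIso :
    Submodule (Smash 𝒜) (GrModCat.self 𝒜).carrier ≃o HomogeneousIdeal 𝒜 where
  toFun L :=
    { carrier := {x | ofRing 𝒜 x ∈ L}
      add_mem' := L.add_mem
      zero_mem' := L.zero_mem
      smul_mem' := fun r x hx => by
        change ofRing 𝒜 (r * x) ∈ L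
        rw [← ι_smul_ofRing]
        exact L.smul_mem _ hx
      is_homogeneous' := fun g x hx => by
        change ofRing 𝒜 _ ∈ L
        rw [← p_smul_ofRing]
        exact L.smul_mem _ hx }
  invFun J :=
    { carrier := {x | (ofRing 𝒜).symm x ∈ J.toSubmodule}
      add_mem' := J.toSubmodule.add_mem
      zero_mem' := J.toSubmodule.zero_mem
      smul_mem' := fun s x => by
        change (ofRing 𝒜).symm x ∈ J.toSubmodule → (ofRing 𝒜).symm (s • x) ∈ J.toSubmodule
        induction s using Smash.induction generalizing x with
        | int n =>
          intro hx
          rw [Int.cast_smul_eq_zsmul, map_zsmul]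
          exact zsmul_mem hx n
        | ι r =>
          obtain ⟨x, rfl⟩ := (ofRing 𝒜).surjective x
          rw [ι_smul_ofRing, AddEquiv.symm_apply_apply, AddEquiv.symm_apply_apply]
          exact J.toSubmodule.smul_mem r
        | p g =>
          obtain ⟨x, rfl⟩ := (ofRing 𝒜).surjective x
          rw [p_smul_ofRing, AddEquiv.symm_apply_apply, AddEquiv.symm_apply_apply]
          exact fun hx => J.is_homogeneous' g hx
        | add a b ha hb =>
          intro hx
          rw [add_smul, map_add]
          exact add_mem (ha x hx) (hb x hx)
        | mul a b ha hb =>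
          intro hx
          rw [mul_smul]
          exact ha _ (hb x hx) }
  left_inv _ := rfl
  right_inv _ := rfl
  map_rel_iff' := Iff.rfl

lemma isGradedLeftNoetherian_iff :
    IsGradedLeftNoetherian 𝒜 ↔ IsNoetherian (Smash 𝒜) ((Smash.system 𝒜).P 0) := by
  rw [(selfEquiv 𝒜).isNoetherian_iff, isNoetherian_iff', IsGradedLeftNoetherian]
  exact ⟨fun h => (submoduleOrderIso 𝒜).strictMono.wellFoundedGT,
    fun h => (submoduleOrderIso 𝒜).symm.strictMono.wellFoundedGT⟩

end Self

end GrModCat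

theorem theorem5p1 {G : Type u} [AddGroup G] [DecidableEq G] {R : Type (max u v)} [Ring R]
    (𝒜 : G → AddSubgroup R) [GradedRing 𝒜] :
    IsGradedQuasiFrobenius 𝒜 ↔
      ∀ M : GrModCat.{u, max u v, max u v} 𝒜,
        CategoryTheory.Injective M ↔ CategoryTheory.Projective M := by
  have hinj : IsGradedLeftInjective 𝒜 ↔ (Smash.system 𝒜).IsInj ((Smash.system 𝒜).P 0) := by
    rw [IsGradedLeftInjective, GrModCat.injective_iff_isInj]
    exact ⟨fun h => h.of_equiv (GrModCat.selfEquiv 𝒜), fun h => h.of_equiv (GrModCat.selfEquiv 𝒜).symm⟩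
  rw [IsGradedQuasiFrobenius, GrModCat.isGradedLeftNoetherian_iff, hinj,
    IdempotentSystem.isNoetherian_and_isInj_iff]
  constructor
  · intro h M
    rw [GrModCat.injective_iff_isInj, GrModCat.projective_iff_isProj]
    exact h M.carrier
  · intro h N _ _ _
    have := h (GrModCat.ofSmash 𝒜 N)
    rw [GrModCat.injective_iff_isInj, GrModCat.projective_iff_isProj] at this
    let e := GrModCat.ofSmashEquiv 𝒜 N
    exact ⟨fun hN => (this.1 (hN.of_equiv e)).of_equiv e.symm,
      fun hN => (this.2 (hN.of_equiv e)).of_equiv e.symm⟩
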